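/- Let $d\ge 1$, $\delta>1$ and $0<\gamma<\frac{\delta}{\delta+1}$. Let $\mathcal X$ be a Poisson process of unit intensity on $\mathbb R^d\times(0,1)$; its points $\mathbf x=(x,t)$ are the vertices, with location $x$ and mark $t$. Let $\mathscr G$ be a random graph given by its conditional laws given the vertex set: for every locally finite $\eta\subset\mathbb R^d\times(0,1)$ let $\mathbb P_\eta$ be the law of a random graph with vertex set $\eta$, depending measurably on $\eta$ (no independence of edges is assumed). Write $\mathbf x\sim\mathbf y$ if $\mathbf x,\mathbf y$ are joined by an edge, and let $\mathrm d(\mathbf x,\mathbf y)\in\mathbb N\cup\{\infty\}$ be the graph distance in $\mathscr G$ (infinite if $\mathbf x,\mathbf y$ are not connected). For $\mathbf x,\mathbf y\in\mathbb R^d\times(0,1)$ let $\mathbb P_{\mathbf x,\mathbf y}=\mathbb E[\mathbb P_{\mathcal X\cup\{\mathbf x,\mathbf y\}}]$ be the law of the graph after adding the vertices $\mathbf x,\mathbf y$ to $\mathcal X$. Assume that there is $\kappa>0$ such that for all $\mathbf x,\mathbf y\in\mathbb R^d\times(0,1)$, for almost every realisation of $\mathcal X$, the vertex set $\eta=\mathcal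 X\cup\{\mathbf x,\mathbf y\}$ satisfies the following: for every finite set $I$ of unordered pairs of distinct vertices of $\eta$ in which each vertex appears at most twice, $$\mathbb P_{\eta}\Big(\bigcap_{\{\mathbf x_i,\mathbf y_i\}\in I}\{\mathbf x_i\sim\mathbf y_i\}\Big)\le\prod_{\{\mathbf x_i,\mathbf y_i\}\in I}\kappa\,(t_i\wedge s_i)^{-\delta\gamma}(t_i\vee s_i)^{\delta(\gamma-1)}|x_i-y_i|^{-\delta d},$$ where $\mathbf x_i=(x_i,t_i)$, $\mathbf y_i=(y_i,s_i)$ (a factor with $x_i=y_i$ is $+\infty$). Then for every $p>1$ there exists $c>0$ such that, for all fixed marks $s,t\in(0,1)$, with $\mathbf x=(x,s)$ and $\mathbf y=(y,t)$, $$\mathbb P_{\mathbf x,\mathbf y}\Big(\mathrm d(\mathbf x,\mathbf y)\ge c\,\frac{\log|x-y|}{(\log\log|x-y|)^p}\Big)\longrightarrow 1\qquad\text{as }|x-y|\to\infty,$$ uniformly over locations $x,y\in\mathbb R^d$ at distance $|x-y|$. -/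

import Mathlib

open MeasureTheory ProbabilityTheory Filter Topology
open scoped ENNReal NNReal

/-- A vertex `(x, t)`: a location `x ∈ ℝ^d` together with a mark `t ∈ (0,1)`. -/
abbrev Vertex (d : ℕ) : Type := EuclideanSpace ℝ (Fin d) × Set.Ioo (0 : ℝ) 1

/-- Lebesgue measure on `ℝ^d × (0,1)`. -/
noncomputable def vertexVolume (d : ℕ) : Measure (Vertex d) :=
  (volume : Measure (EuclideanSpace ℝ (Fin d))).prod
    (Measure.comap (Subtype.val : Set.Ioo (0 : ℝ) 1 → ℝ) volume)

/-- A vertex configuration: a locally finite set of vertices.  (Marks lie in a bounded interval,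
so a set of vertices is bounded exactly when its set of locations is.) -/
structure Configuration (d : ℕ) where
  /-- the set of vertices -/
  carrier : Set (Vertex d)
  locallyFinite : ∀ B : Set (Vertex d), Bornology.IsBounded B → (carrier ∩ B).Finite

/-- The usual σ-algebra on configurations, generated by the numbers of points in measurable
sets. -/
noncomputable instance (d : ℕ) : MeasurableSpace (Configuration d) :=
  ⨆ (B : Set (Vertex d)) (_ : MeasurableSet B),
    MeasurableSpace.comap (fun η : Configuration d => (η.carrier ∩ B).encard) ⊤

/-- The configuration `η ∪ {x}`. -/
def Configuration.addPoint {d : ℕ} (η : Configuration d) (x : Vertex d) : Configuration d where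
  carrier := insert x η.carrier
  locallyFinite := by
    intro B hB
    refine ((η.locallyFinite B hB).insert x).subset ?_
    rintro z ⟨hz | hz, hzB⟩
    · exact Or.inl hz
    · exact Or.inr ⟨hz, hzB⟩

/-- `Λ` is the law of a Poisson process of unit intensity on `ℝ^d × (0,1)`: the number of points in
a measurable set of finite volume is Poisson distributed with mean the volume, and the numbers of
points in disjoint measurable sets are independent. -/
structure IsUnitPoissonLaw {d : ℕ} (Λ : Measure (Configuration d)) : Prop where
  isProbabilityMeasure : IsProbabilityMeasure Λ
  count : ∀ B : Set (Vertex d), MeasurableSet B → vertexVolume d B ≠ ∞ → ∀ k : ℕ,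
    Λ {η | (η.carrier ∩ B).encard = (k : ℕ∞)} = poissonMeasure (vertexVolume d B).toNNReal {k}
  indep : ∀ (n : ℕ) (B : Fin n → Set (Vertex d)), (∀ i, MeasurableSet (B i)) →
    Pairwise (fun i j => Disjoint (B i) (B j)) →
    iIndepFun (m := fun _ => (⊤ : MeasurableSpace ℕ∞))
      (fun (i : Fin n) (η : Configuration d) => (η.carrier ∩ B i).encard) Λ

/-- The σ-algebra on graphs over the space of vertices, generated by the numbers of (ordered) edges
in measurable sets of pairs of vertices, that is, a graph is identified with the point process
of its edges. -/
noncomputable instance (d : ℕ) : MeasurableSpace (SimpleGraph (Vertex d)) :=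
  ⨆ (C : Set (Vertex d × Vertex d)) (_ : MeasurableSet C),
    MeasurableSpace.comap
      (fun G : SimpleGraph (Vertex d) => {p | p ∈ C ∧ G.Adj p.1 p.2}.encard) ⊤

/-- A geometric random graph, given by its conditional laws given the vertex set: `law η` is the law
of the edges when the vertex set is `η`; edges only join points of `η`.  No independence of
edges is required. -/
structure GeometricRandomGraph (d : ℕ) where
  /-- the conditional law of the edges given the vertex set -/
  law : Kernel (Configuration d) (SimpleGraph (Vertex d))
  isMarkov : IsMarkovKernel law
  mem_of_adj : ∀ η : Configuration d, ∀ᵐ G ∂(law η),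
    ∀ x y : Vertex d, G.Adj x y → x ∈ η.carrier ∧ y ∈ η.carrier

/-- The factor `κ (t ∧ s)^{-δγ} (t ∨ s)^{δ(γ-1)} |x - y|^{-δd}` for the vertices `(x,t)` and `(y,s)`,
with value `∞` if `x = y`. -/
noncomputable def edgeFactor {d : ℕ} (κ δ γ : ℝ) (x y : Vertex d) : ℝ≥0∞ :=
  ENNReal.ofReal κ
    * ENNReal.ofReal (min (x.2 : ℝ) (y.2 : ℝ)) ^ (-(δ * γ))
    * ENNReal.ofReal (max (x.2 : ℝ) (y.2 : ℝ)) ^ (δ * (γ - 1))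
    * ENNReal.ofReal ‖x.1 - y.1‖ ^ (-(δ * (d : ℝ)))

open Classical in
/-- The bound on joint edge probabilities for the vertex set `η`: for every finite set `I` of pairs
of distinct points of `η` (each pair listed in one order only) such that each vertex appears at
most twice in `I`, the probability that all pairs in `I` are edges is at most the product of the
edge factors. -/
def GeometricRandomGraph.EdgeBoundAt {d : ℕ} (𝒢 : GeometricRandomGraph d) (κ δ γ : ℝ)
    (η : Configuration d) : Prop :=
  ∀ I : Finset (Vertex d × Vertex d),
    (∀ e ∈ I, e.1 ∈ η.carrier ∧ e.2 ∈ η.carrier) →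
    (∀ e ∈ I, e.swap ∉ I) →
    (∀ v : Vertex d, (I.filter (fun e => e.1 = v)).card + (I.filter (fun e => e.2 = v)).card ≤ 2) →
    𝒢.law η {G | ∀ e ∈ I, G.Adj e.1 e.2} ≤ ∏ e ∈ I, edgeFactor κ δ γ e.1 e.2

/-- The upper bound on edge probabilities with parameters `δ`, `γ`: there is a constant `κ > 0` such
that, whenever two vertices `x`, `y` are added to the Poisson process with law `Λ`, the bound on
joint edge probabilities holds almost surely given the resulting vertex set. -/
def GeometricRandomGraph.EdgeBound {d : ℕ} (𝒢 : GeometricRandomGraph d)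
    (Λ : Measure (Configuration d)) (δ γ : ℝ) : Prop :=
  ∃ κ : ℝ, 0 < κ ∧ ∀ x y : Vertex d, ∀ᵐ η ∂Λ,
    𝒢.EdgeBoundAt κ δ γ ((η.addPoint x).addPoint y)

/-- The probability `ℙ_{x,y}(A)` of an event `A` for the graph whose vertex set is the Poisson
process with law `Λ` to which the vertices `x` and `y` are added. -/
noncomputable def GeometricRandomGraph.palmProb {d : ℕ} (𝒢 : GeometricRandomGraph d)
    (Λ : Measure (Configuration d)) (x y : Vertex d) (A : Set (SimpleGraph (Vertex d))) : ℝ≥0∞ :=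
  ∫⁻ η, 𝒢.law ((η.addPoint x).addPoint y) A ∂Λ

/-!
If the edge factor of a pair of vertices is at least `1`, the assumed bound says nothing about that
pair, so all such pairs are joined first; this can only shorten distances. A geodesic of the
augmented graph has no shortcuts, hence two vertices of it with edge factor at least `1` are
consecutive. Its strongest inner vertex is far from one of the two endpoints, so it suffices to
bound the expected number of shortcut-free paths that lead from a fixed vertex to a strongest
vertex at distance at least `r / 2`.

Splitting a shortcut-free path at its strongest inner vertex, and continuing recursively in both
parts, encodes it in a labelled binary tree. Each split amounts to connecting two vertices that are
not joined for free through a weaker one, and for `γ < δ / (δ + 1)` the integral over this weaker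
vertex costs only a constant factor: the edge factor `w`, capped at `1`, satisfies
`∫ w a u * w u b ≤ K * w a b`. A step to a stronger vertex is controlled in the same way by a moment
of its location and mark. As there are at most `4 ^ n` binary trees with `n` nodes, at most
`C * B ^ N * r ^ (-β)` such paths of length at most `N` are expected, and this tends to zero for
`N = ⌊c * log r⌋` with `c` small. The distance is therefore of order at least `log r`, even without
the factor `log log`.
-/

section PoissonProcess

variable {d : ℕ}

/-- Lebesgue measure on the space `(0,1)` of marks. -/
noncomputable def markVolume : Measure (Set.Ioo (0 : ℝ) 1) :=
  Measure.comap Subtype.val volume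

theorem lintegral_markVolume (f : ℝ → ℝ≥0∞) :
    ∫⁻ t : Set.Ioo (0 : ℝ) 1, f t ∂markVolume = ∫⁻ t in Set.Ioo (0 : ℝ) 1, f t :=
  lintegral_subtype_comap measurableSet_Ioo f

instance : IsFiniteMeasure markVolume := by
  refine ⟨?_⟩
  simpa using (lintegral_markVolume fun _ => 1).trans_lt (by simp)

theorem vertexVolume_eq_prod : vertexVolume d = volume.prod markVolume := rfl

instance : SigmaFinite (vertexVolume d) :=
  inferInstanceAs (SigmaFinite (volume.prod markVolume))

theorem vertexVolume_ne_top_of_isBounded {B : Set (Vertex d)} (hB : Bornology.IsBounded B) :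
    vertexVolume d B ≠ ∞ := by
  have hsub : B ⊆ (Prod.fst '' B) ×ˢ Set.univ := fun z hz => ⟨⟨z, hz, rfl⟩, trivial⟩
  refine ((measure_mono hsub).trans_lt ?_).ne
  rw [vertexVolume_eq_prod, Measure.prod_prod]
  exact ENNReal.mul_lt_top hB.image_fst.measure_lt_top (measure_lt_top _ _)

theorem Configuration.measurable_encard_inter {B : Set (Vertex d)} (hB : MeasurableSet B) :
    Measurable[_, ⊤] (fun η : Configuration d => (η.carrier ∩ B).encard) := by
  rw [measurable_iff_comap_le]
  exact le_iSup₂_of_le B hB le_rfl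

theorem Configuration.measurable_coe_encard_inter {B : Set (Vertex d)} (hB : MeasurableSet B) :
    Measurable (fun η : Configuration d => ((η.carrier ∩ B).encard : ℝ≥0∞)) :=
  Measurable.comp (g := fun n : ℕ∞ => (n : ℝ≥0∞)) measurable_from_top
    (Configuration.measurable_encard_inter hB)

theorem Configuration.countable_carrier (η : Configuration d) : η.carrier.Countable := by
  rcases η.carrier.eq_empty_or_nonempty with hempty | ⟨v, -⟩
  · exact hempty ▸ Set.countable_empty
  · rw [← Set.inter_univ η.carrier, ← Metric.iUnion_ball_nat v, Set.inter_iUnion]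
    exact Set.countable_iUnion fun n => (η.locallyFinite _ Metric.isBounded_ball).countable

theorem lintegral_cast_poissonMeasure (v : ℝ≥0) :
    ∫⁻ k : ℕ, (k : ℝ≥0∞) ∂(poissonMeasure v) = v := by
  have htotal : ∑' k : ℕ, poissonMeasure v {k} = 1 := by
    simpa using (lintegral_countable' (μ := poissonMeasure v) fun _ => 1).symm
  have hshift : ∀ k : ℕ, ((k + 1 : ℕ) : ℝ≥0∞) * poissonMeasure v {k + 1}
      = v * poissonMeasure v {k} := by
    intro k
    rw [poissonMeasure_singleton, poissonMeasure_singleton, ← ENNReal.ofReal_natCast,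
      ← ENNReal.ofReal_coe_nnreal, ← ENNReal.ofReal_mul (by positivity),
      ← ENNReal.ofReal_mul (by positivity), Nat.factorial_succ]
    congr 1
    push_cast
    field_simp
    ring
  rw [lintegral_countable', tsum_eq_zero_add' ENNReal.summable]
  simp_rw [hshift, ENNReal.tsum_mul_left, htotal]
  simp

theorem Configuration.preimage_ncard_inter {B : Set (Vertex d)} (hb : Bornology.IsBounded B)
    (k : ℕ) : (fun η : Configuration d => (η.carrier ∩ B).ncard) ⁻¹' {k}
      = {η | (η.carrier ∩ B).encard = (k : ℕ∞)} := by
  ext η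
  rw [Set.mem_ofPred_eq, ← (η.locallyFinite B hb).cast_ncard_eq, Nat.cast_inj]
  rfl

theorem Configuration.measurable_ncard_inter {B : Set (Vertex d)} (hB : MeasurableSet B)
    (hb : Bornology.IsBounded B) :
    Measurable fun η : Configuration d => (η.carrier ∩ B).ncard := by
  refine measurable_to_countable' fun k => ?_
  rw [preimage_ncard_inter hb]
  exact measurable_encard_inter hB (MeasurableSpace.measurableSet_top (s := {(k : ℕ∞)}))

theorem IsUnitPoissonLaw.map_ncard_inter {Λ : Measure (Configuration d)}
    (hΛ : IsUnitPoissonLaw Λ) {B : Set (Vertex d)} (hB : MeasurableSet B)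
    (hb : Bornology.IsBounded B) :
    Λ.map (fun η => (η.carrier ∩ B).ncard) = poissonMeasure (vertexVolume d B).toNNReal := by
  refine Measure.ext_of_singleton fun k => ?_
  rw [Measure.map_apply (Configuration.measurable_ncard_inter hB hb) (measurableSet_singleton k),
    Configuration.preimage_ncard_inter hb, hΛ.count B hB (vertexVolume_ne_top_of_isBounded hb)]

theorem IsUnitPoissonLaw.lintegral_encard_inter {Λ : Measure (Configuration d)}
    (hΛ : IsUnitPoissonLaw Λ) {B : Set (Vertex d)} (hB : MeasurableSet B)
    (hb : Bornology.IsBounded B) :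
    ∫⁻ η, ((η.carrier ∩ B).encard : ℝ≥0∞) ∂Λ = vertexVolume d B := by
  calc ∫⁻ η, ((η.carrier ∩ B).encard : ℝ≥0∞) ∂Λ
      = ∫⁻ η, ((η.carrier ∩ B).ncard : ℝ≥0∞) ∂Λ := by
        refine lintegral_congr fun η => ?_
        rw [← (η.locallyFinite B hb).cast_ncard_eq, ENat.toENNReal_coe]
    _ = ∫⁻ k : ℕ, (k : ℝ≥0∞) ∂(Λ.map fun η => (η.carrier ∩ B).ncard) := by
        rw [lintegral_map measurable_from_top (Configuration.measurable_ncard_inter hB hb)]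
    _ = vertexVolume d B := by
        rw [hΛ.map_ncard_inter hB hb, lintegral_cast_poissonMeasure,
          ENNReal.coe_toNNReal (vertexVolume_ne_top_of_isBounded hb)]

theorem IsUnitPoissonLaw.lintegral_prod_encard_inter {Λ : Measure (Configuration d)}
    (hΛ : IsUnitPoissonLaw Λ) {ι : Type*} [Fintype ι] {B : ι → Set (Vertex d)}
    (hB : ∀ i, MeasurableSet (B i)) (hb : ∀ i, Bornology.IsBounded (B i))
    (hd : Pairwise fun i j => Disjoint (B i) (B j)) :
    ∫⁻ η, ∏ i, ((η.carrier ∩ B i).encard : ℝ≥0∞) ∂Λ = ∏ i, vertexVolume d (B i) := by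
  have e := Fintype.equivFin ι
  have hindep := ((hΛ.indep (Fintype.card ι) (fun j => B (e.symm j)) (fun j => hB _)
    fun i j hij => hd (e.symm.injective.ne hij)).comp (fun _ (n : ℕ∞) => (n : ℝ≥0∞))
      fun _ => measurable_from_top).precomp e.injective
  rw [lintegral_prod_eq_prod_lintegral_of_indepFun Finset.univ
    (fun i (η : Configuration d) => ((η.carrier ∩ B i).encard : ℝ≥0∞))
    (by simpa [Function.comp_def] using hindep)
    fun i => Configuration.measurable_coe_encard_inter (hB i)]
  exact Finset.prod_congr rfl fun i _ => hΛ.lintegral_encard_inter (hB i) (hb i)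

end PoissonProcess

section CountingMeasure

variable {d : ℕ} {ι : Type*} [Fintype ι]

/-- The counting measure of the points of a configuration in `B`. -/
noncomputable def Configuration.countIn (η : Configuration d) (B : Set (Vertex d)) :
    Measure (Vertex d) :=
  Measure.count.restrict (η.carrier ∩ B)

theorem Configuration.countIn_apply (η : Configuration d) (B : Set (Vertex d))
    {A : Set (Vertex d)} (hA : MeasurableSet A) :
    η.countIn B A = ((η.carrier ∩ (B ∩ A)).encard : ℝ≥0∞) := by
  rw [countIn, Measure.restrict_apply hA, Set.inter_comm A, Set.inter_assoc]
  exact Measure.count_apply (η.countable_carrier.mono Set.inter_subset_left).measurableSet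

theorem Configuration.isFiniteMeasure_countIn (η : Configuration d) {B : Set (Vertex d)}
    (hB : Bornology.IsBounded B) : IsFiniteMeasure (η.countIn B) := by
  refine ⟨?_⟩
  rw [countIn_apply _ _ MeasurableSet.univ, Set.inter_univ]
  simpa using (η.locallyFinite B hB).encard_lt_top

theorem Configuration.measurable_pi_countIn {B : ι → Set (Vertex d)}
    (hB : ∀ i, MeasurableSet (B i)) (hb : ∀ i, Bornology.IsBounded (B i)) :
    Measurable fun η : Configuration d => Measure.pi fun i => η.countIn (B i) := by
  have hfin : ∀ (η : Configuration d) i, IsFiniteMeasure (η.countIn (B i)) :=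
    fun η i => η.isFiniteMeasure_countIn (hb i)
  have hbox : ∀ s : ι → Set (Vertex d), (∀ i, MeasurableSet (s i)) →
      Measurable fun η : Configuration d =>
        (Measure.pi fun i => η.countIn (B i)) (Set.univ.pi s) := by
    intro s hs
    simp_rw [Measure.pi_pi, fun (η : Configuration d) i => η.countIn_apply (B i) (hs i)]
    exact Finset.measurable_prod _ fun i _ => measurable_coe_encard_inter ((hB i).inter (hs i))
  refine Measurable.measure_of_isPiSystem generateFrom_pi.symm isPiSystem_pi ?_ ?_
  · rintro _ ⟨s, hs, rfl⟩
    exact hbox s fun i => hs i trivial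
  · simpa using hbox (fun _ => Set.univ) fun _ => MeasurableSet.univ

theorem IsUnitPoissonLaw.bind_pi_countIn {Λ : Measure (Configuration d)}
    (hΛ : IsUnitPoissonLaw Λ) {B : ι → Set (Vertex d)}
    (hB : ∀ i, MeasurableSet (B i)) (hb : ∀ i, Bornology.IsBounded (B i))
    (hd : Pairwise fun i j => Disjoint (B i) (B j)) :
    Λ.bind (fun η => Measure.pi fun i => η.countIn (B i))
      = (Measure.pi fun _ => vertexVolume d).restrict (Set.univ.pi B) := by
  have hfin : ∀ (η : Configuration d) i, IsFiniteMeasure (η.countIn (B i)) :=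
    fun η i => η.isFiniteMeasure_countIn (hb i)
  rw [Measure.restrict_pi_pi]
  refine (Measure.pi_eq fun s hs => ?_).symm
  rw [Measure.bind_apply (MeasurableSet.univ_pi hs)
    (Configuration.measurable_pi_countIn hB hb).aemeasurable]
  simp_rw [Measure.pi_pi, fun (η : Configuration d) i => η.countIn_apply (B i) (hs i)]
  rw [hΛ.lintegral_prod_encard_inter (fun i => (hB i).inter (hs i))
    (fun i => (hb i).subset Set.inter_subset_left)
    (fun i j hij => (hd hij).mono Set.inter_subset_left Set.inter_subset_left)]
  exact Finset.prod_congr rfl fun i _ => by rw [Measure.restrict_apply (hs i), Set.inter_comm]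

theorem Configuration.tsum_le_lintegral_pi_countIn (η : Configuration d)
    {B : ι → Set (Vertex d)} (hb : ∀ i, Bornology.IsBounded (B i))
    (g : (ι → Vertex d) → ℝ≥0∞) :
    ∑' x : Set.univ.pi fun i => η.carrier ∩ B i, g x
      ≤ ∫⁻ x, g x ∂(Measure.pi fun i => η.countIn (B i)) := by
  have hfin : ∀ i, IsFiniteMeasure (η.countIn (B i)) :=
    fun i => η.isFiniteMeasure_countIn (hb i)
  have hatom : ∀ x ∈ Set.univ.pi fun i => η.carrier ∩ B i,
      Measure.pi (fun i => η.countIn (B i)) {x} = 1 := by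
    intro x hx
    rw [Measure.pi_singleton]
    refine Finset.prod_eq_one fun i _ => ?_
    rw [countIn_apply _ _ (measurableSet_singleton _), ← Set.inter_assoc,
      Set.inter_eq_right.2 (Set.singleton_subset_iff.2 (hx i trivial)), Set.encard_singleton,
      ENat.toENNReal_one]
  have hcount : (Set.univ.pi fun i => η.carrier ∩ B i).Countable :=
    Set.countable_univ_pi fun i => η.countable_carrier.mono Set.inter_subset_left
  calc ∑' x : Set.univ.pi fun i => η.carrier ∩ B i, g x
      = ∑' x : Set.univ.pi fun i => η.carrier ∩ B i,
          g x * Measure.pi (fun i => η.countIn (B i)) {x.1} :=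
        tsum_congr fun x => by rw [hatom x x.2, mul_one]
    _ = ∫⁻ x in Set.univ.pi fun i => η.carrier ∩ B i, g x
          ∂(Measure.pi fun i => η.countIn (B i)) := (lintegral_countable g hcount).symm
    _ ≤ ∫⁻ x, g x ∂(Measure.pi fun i => η.countIn (B i)) := setLIntegral_le_lintegral _ _

end CountingMeasure

section Grid

variable {d : ℕ}

/-- The index of the cell that contains a vertex in the grid of mesh `1 / (k + 1)`. -/
noncomputable def gridIndex (k : ℕ) (v : Vertex d) : (Fin d → ℤ) × ℤ :=
  (fun i => ⌊((k : ℝ) + 1) * v.1 i⌋, ⌊((k : ℝ) + 1) * (v.2 : ℝ)⌋)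

/-- The cell of the grid of mesh `1 / (k + 1)` with a given index. -/
def gridCell (k : ℕ) (c : (Fin d → ℤ) × ℤ) : Set (Vertex d) := gridIndex k ⁻¹' {c}

theorem measurable_gridIndex (k : ℕ) : Measurable (gridIndex (d := d) k) := by
  unfold gridIndex
  fun_prop

theorem measurableSet_gridCell (k : ℕ) (c : (Fin d → ℤ) × ℤ) :
    MeasurableSet (gridCell k c) :=
  measurable_gridIndex k (measurableSet_singleton c)

theorem disjoint_gridCell (k : ℕ) {c c' : (Fin d → ℤ) × ℤ} (h : c ≠ c') :
    Disjoint (gridCell k c) (gridCell k c') :=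
  Disjoint.preimage _ (Set.disjoint_singleton.2 h)

theorem abs_le_of_floor_mul_eq {k : ℕ} {a : ℝ} {n : ℤ} (h : ⌊((k : ℝ) + 1) * a⌋ = n) :
    |a| ≤ |(n : ℝ)| + 1 := by
  obtain ⟨hlow, hup⟩ := Int.floor_eq_iff.1 h
  have hscaled : |((k : ℝ) + 1) * a| ≤ |(n : ℝ)| + 1 :=
    abs_le.2 ⟨by linarith [neg_abs_le (n : ℝ)], by linarith [le_abs_self (n : ℝ)]⟩
  rw [abs_mul, abs_of_pos (by positivity)] at hscaled
  nlinarith [abs_nonneg a, (Nat.cast_nonneg k : (0 : ℝ) ≤ k)]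

theorem isBounded_gridCell (k : ℕ) (c : (Fin d → ℤ) × ℤ) :
    Bornology.IsBounded (gridCell k c) := by
  have hlocation : Bornology.IsBounded
      ((WithLp.ofLp : EuclideanSpace ℝ (Fin d) → Fin d → ℝ) ⁻¹'
        Set.Icc (fun i => -(|(c.1 i : ℝ)| + 1)) fun i => |(c.1 i : ℝ)| + 1) :=
    (PiLp.antilipschitzWith_ofLp 2 _).isBounded_preimage (Metric.isBounded_Icc _ _)
  have hmark : Bornology.IsBounded (Set.univ : Set (Set.Ioo (0 : ℝ) 1)) := by
    refine Metric.isBounded_iff.2 ⟨1, fun x _ y _ => ?_⟩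
    rw [Subtype.dist_eq, Real.dist_eq, abs_le]
    constructor <;> linarith [x.2.1, x.2.2, y.2.1, y.2.2]
  refine (hlocation.prod hmark).subset fun v hv => ⟨?_, trivial⟩
  have habs : ∀ i, |v.1 i| ≤ |(c.1 i : ℝ)| + 1 := fun i =>
    abs_le_of_floor_mul_eq (congrFun (congrArg Prod.fst (show gridIndex k v = c from hv)) i)
  exact ⟨fun i => (abs_le.1 (habs i)).1, fun i => (abs_le.1 (habs i)).2⟩

theorem eventually_floor_mul_ne {a b : ℝ} (hab : a ≠ b) :
    ∀ᶠ k : ℕ in atTop, ⌊((k : ℝ) + 1) * a⌋ ≠ ⌊((k : ℝ) + 1) * b⌋ := by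
  obtain ⟨N, hN⟩ := exists_nat_gt (1 / |a - b|)
  have hpos : 0 < |a - b| := abs_pos.2 (sub_ne_zero.2 hab)
  rw [div_lt_iff₀ hpos] at hN
  filter_upwards [eventually_ge_atTop N] with k hk heq
  have hclose := Int.abs_sub_lt_one_of_floor_eq_floor heq
  rw [← mul_sub, abs_mul, abs_of_pos (by positivity)] at hclose
  have hNk : (N : ℝ) ≤ k := by exact_mod_cast hk
  nlinarith

theorem eventually_gridIndex_ne {v w : Vertex d} (h : v ≠ w) :
    ∀ᶠ k in atTop, gridIndex k v ≠ gridIndex k w := by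
  by_cases hlocation : v.1 = w.1
  · have hmark : (v.2 : ℝ) ≠ w.2 := fun h2 => h (Prod.ext hlocation (Subtype.ext h2))
    filter_upwards [eventually_floor_mul_ne hmark] with k hk heq
    exact hk (congrArg Prod.snd heq)
  · obtain ⟨i, hi⟩ : ∃ i, v.1 i ≠ w.1 i := by
      by_contra! hall
      exact hlocation (PiLp.ext hall)
    filter_upwards [eventually_floor_mul_ne hi] with k hk heq
    exact hk (congrFun (congrArg Prod.fst heq) i)

theorem eventually_injective_gridIndex {ι : Type*} [Finite ι] {x : ι → Vertex d}
    (hx : Function.Injective x) :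
    ∀ᶠ k in atTop, Function.Injective fun i => gridIndex k (x i) := by
  have hpairs : ∀ᶠ k in atTop, ∀ i j, i ≠ j → gridIndex k (x i) ≠ gridIndex k (x j) :=
    eventually_all.2 fun i => eventually_all.2 fun j => eventually_imp_distrib_left.2
      fun hij => eventually_gridIndex_ne (hx.ne hij)
  filter_upwards [hpairs] with k hk i j hij
  exact of_not_not fun hne => hk i j hne hij

end Grid

section CampbellMecke

variable {d : ℕ} {ι : Type*} [Fintype ι]

/-- The labellings of `ι` by distinct points of a configuration. -/
def Configuration.labellings (η : Configuration d) (ι : Type*) : Set (ι → Vertex d) :=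
  {x | Function.Injective x ∧ ∀ i, x i ∈ η.carrier}

/-- The sum of `g` over the labellings of `ι` by points of a configuration in distinct cells of the
grid of mesh `1 / (k + 1)`. As the cells are disjoint, the points in them are independent. -/
noncomputable def Configuration.gridSum (η : Configuration d) (k : ℕ)
    (g : (ι → Vertex d) → ℝ≥0∞) : ℝ≥0∞ :=
  ∑' c : {c : ι → (Fin d → ℤ) × ℤ // Function.Injective c},
    ∫⁻ x, g x ∂(Measure.pi fun i => η.countIn (gridCell k (c.1 i)))

theorem Configuration.measurable_gridSum (k : ℕ) {g : (ι → Vertex d) → ℝ≥0∞}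
    (hg : Measurable g) : Measurable fun η : Configuration d => η.gridSum k g :=
  Measurable.tsum fun _ => (Measure.measurable_lintegral hg).comp
    (measurable_pi_countIn (fun _ => measurableSet_gridCell k _) fun _ => isBounded_gridCell k _)

theorem IsUnitPoissonLaw.lintegral_gridSum_le {Λ : Measure (Configuration d)}
    (hΛ : IsUnitPoissonLaw Λ) (k : ℕ) {g : (ι → Vertex d) → ℝ≥0∞} (hg : Measurable g) :
    ∫⁻ η, η.gridSum k g ∂Λ ≤ ∫⁻ x, g x ∂(Measure.pi fun _ => vertexVolume d) := by
  let J := {c : ι → (Fin d → ℤ) × ℤ // Function.Injective c}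
  have hmeas := fun c : J => Configuration.measurable_pi_countIn
    (fun i => measurableSet_gridCell k (c.1 i)) (fun i => isBounded_gridCell k (c.1 i))
  have hcell : ∀ c : J, ∫⁻ η, ∫⁻ x, g x ∂(Measure.pi fun i => η.countIn (gridCell k (c.1 i))) ∂Λ
      = ∫⁻ x in Set.univ.pi fun i => gridCell k (c.1 i), g x
          ∂(Measure.pi fun _ => vertexVolume d) := by
    intro c
    rw [← Measure.lintegral_bind (hmeas c).aemeasurable hg.aemeasurable,
      hΛ.bind_pi_countIn (fun i => measurableSet_gridCell k (c.1 i))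
        (fun i => isBounded_gridCell k (c.1 i))
        (fun i j hij => disjoint_gridCell k (c.2.ne hij))]
  have hdisjoint : Pairwise fun c c' : J => Disjoint
      (Set.univ.pi fun i => gridCell k (c.1 i)) (Set.univ.pi fun i => gridCell k (c'.1 i)) := by
    intro c c' hne
    obtain ⟨i, hi⟩ := Function.ne_iff.1 (Subtype.coe_injective.ne hne)
    exact Set.disjoint_univ_pi.2 ⟨i, disjoint_gridCell k hi⟩
  calc ∫⁻ η, η.gridSum k g ∂Λ
      = ∑' c : J, ∫⁻ x in Set.univ.pi fun i => gridCell k (c.1 i), g x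
          ∂(Measure.pi fun _ => vertexVolume d) :=
        (lintegral_tsum fun c =>
          ((Measure.measurable_lintegral hg).comp (hmeas c)).aemeasurable).trans
            (tsum_congr hcell)
    _ = ∫⁻ x in ⋃ c : J, Set.univ.pi fun i => gridCell k (c.1 i), g x
          ∂(Measure.pi fun _ => vertexVolume d) :=
        (lintegral_iUnion (fun c => MeasurableSet.univ_pi fun i => measurableSet_gridCell k _)
          hdisjoint _).symm
    _ ≤ ∫⁻ x, g x ∂(Measure.pi fun _ => vertexVolume d) := setLIntegral_le_lintegral _ _

theorem Configuration.sum_le_gridSum (η : Configuration d) (k : ℕ)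
    (g : (ι → Vertex d) → ℝ≥0∞) {S : Finset (ι → Vertex d)}
    (hS : ∀ x ∈ S, ∀ i, x i ∈ η.carrier)
    (hsep : ∀ x ∈ S, Function.Injective fun i => gridIndex k (x i)) :
    ∑ x ∈ S, g x ≤ η.gridSum k g := by
  let cells : S → {c : ι → (Fin d → ℤ) × ℤ // Function.Injective c} :=
    fun x => ⟨fun i => gridIndex k (x.1 i), hsep x x.2⟩
  rw [← Finset.tsum_subtype, ← (Equiv.sigmaFiberEquiv cells).tsum_eq,
    ENNReal.summable.tsum_sigma' fun _ => ENNReal.summable]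
  refine ENNReal.tsum_le_tsum fun c => ?_
  refine le_trans ?_ (η.tsum_le_lintegral_pi_countIn (fun i => isBounded_gridCell k (c.1 i)) g)
  let inCells : {x // cells x = c} → Set.univ.pi fun i => η.carrier ∩ gridCell k (c.1 i) :=
    fun x => ⟨x.1.1, fun i _ => ⟨hS _ x.1.2 i, congrFun (congrArg Subtype.val x.2) i⟩⟩
  have hinj : Function.Injective inCells := fun x y hxy =>
    Subtype.ext (Subtype.ext (congrArg (fun z => z.1) hxy))
  exact ENNReal.tsum_comp_le_tsum_of_injective hinj fun x => g x.1

theorem Configuration.tsum_labellings_le_liminf_gridSum (η : Configuration d)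
    (g : (ι → Vertex d) → ℝ≥0∞) :
    ∑' x : η.labellings ι, g x ≤ liminf (fun k => η.gridSum k g) atTop := by
  classical
  rw [ENNReal.tsum_eq_iSup_sum]
  refine iSup_le fun S => le_liminf_of_le (by isBoundedDefault) ?_
  have hsep : ∀ᶠ k in atTop, ∀ x ∈ S, Function.Injective fun i => gridIndex k (x.1 i) :=
    (Filter.eventually_all_finset S).2 fun x _ => eventually_injective_gridIndex x.2.1
  filter_upwards [hsep] with k hk
  refine (Finset.sum_map S (Function.Embedding.subtype _) g).ge.trans (η.sum_le_gridSum k g ?_ ?_)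
  · intro x hx
    obtain ⟨y, -, rfl⟩ := Finset.mem_map.1 hx
    exact y.2.2
  · intro x hx
    obtain ⟨y, hy, rfl⟩ := Finset.mem_map.1 hx
    exact hk y hy

-- One half of the Campbell–Mecke formula; the measurable majorant `F` avoids a proof that the sum
-- over labellings is itself measurable in `η`.
theorem IsUnitPoissonLaw.exists_tsum_labellings_le {Λ : Measure (Configuration d)}
    (hΛ : IsUnitPoissonLaw Λ) {g : (ι → Vertex d) → ℝ≥0∞} (hg : Measurable g) :
    ∃ F : Configuration d → ℝ≥0∞, Measurable F ∧
      (∀ η, ∑' x : η.labellings ι, g x ≤ F η) ∧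
      ∫⁻ η, F η ∂Λ ≤ ∫⁻ x, g x ∂(Measure.pi fun _ => vertexVolume d) := by
  have hmeas := fun k => Configuration.measurable_gridSum (d := d) k hg
  refine ⟨fun η => liminf (fun k => η.gridSum k g) atTop, Measurable.liminf hmeas,
    fun η => η.tsum_labellings_le_liminf_gridSum g, ?_⟩
  calc ∫⁻ η, liminf (fun k => η.gridSum k g) atTop ∂Λ
      ≤ liminf (fun k => ∫⁻ η, η.gridSum k g ∂Λ) atTop := lintegral_liminf_le hmeas
    _ ≤ liminf (fun _ : ℕ => ∫⁻ x, g x ∂(Measure.pi fun _ => vertexVolume d)) atTop :=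
      liminf_le_liminf (Eventually.of_forall fun k => hΛ.lintegral_gridSum_le k hg)
    _ = ∫⁻ x, g x ∂(Measure.pi fun _ => vertexVolume d) := liminf_const _

end CampbellMecke

section EdgeFactor

variable {d : ℕ} {κ δ γ : ℝ}

/-- The factor of `edgeFactor` that depends on the marks. -/
noncomputable def markFactor (κ δ γ s t : ℝ) : ℝ :=
  κ * min s t ^ (-(δ * γ)) * max s t ^ (δ * (γ - 1))

theorem markFactor_pos {s t : ℝ} (hκ : 0 < κ) (hs : 0 < s) (ht : 0 < t) :
    0 < markFactor κ δ γ s t := by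
  have hmin : 0 < min s t := lt_min hs ht
  have hmax : 0 < max s t := lt_max_of_lt_left hs
  unfold markFactor
  positivity

theorem markFactor_of_le {s t : ℝ} (h : s ≤ t) :
    markFactor κ δ γ s t = κ * s ^ (-(δ * γ)) * t ^ (δ * (γ - 1)) := by
  rw [markFactor, min_eq_left h, max_eq_right h]

theorem markFactor_of_ge {s t : ℝ} (h : t ≤ s) :
    markFactor κ δ γ s t = κ * t ^ (-(δ * γ)) * s ^ (δ * (γ - 1)) := by
  rw [markFactor, min_eq_right h, max_eq_left h]

theorem markFactor_mono {γ' s t : ℝ} (hκ : 0 ≤ κ) (hδ : 0 ≤ δ) (hγ : γ ≤ γ') (hs : 0 < s)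
    (ht : 0 < t) : markFactor κ δ γ s t ≤ markFactor κ δ γ' s t := by
  have hmin : 0 < min s t := lt_min hs ht
  have hmax : 0 < max s t := lt_max_of_lt_left hs
  have hratio : ∀ β, markFactor κ δ β s t
      = κ * max s t ^ (-δ) * (max s t / min s t) ^ (δ * β) := fun β => by
    rw [markFactor, Real.div_rpow hmax.le hmin.le, show δ * (β - 1) = -δ + δ * β by ring,
      Real.rpow_add hmax, Real.rpow_neg hmin.le]
    ring
  rw [hratio, hratio]
  gcongr
  exact (one_le_div hmin).2 min_le_max

theorem markFactor_le {s t : ℝ} (hκ : 0 ≤ κ) (hδ : 0 ≤ δ) (hγ₀ : 0 ≤ γ) (hγ : γ ≤ 1)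
    (hs : 0 < s) (hs1 : s ≤ 1) (ht : 0 < t) (ht1 : t ≤ 1) :
    markFactor κ δ γ s t ≤ κ * s ^ (-δ) * t ^ (-(δ * γ)) := by
  have hδγ : 0 ≤ δ * γ := mul_nonneg hδ hγ₀
  rcases le_total s t with hst | hts
  · calc markFactor κ δ γ s t = κ * s ^ (-(δ * γ)) * t ^ (δ * (γ - 1)) := markFactor_of_le hst
      _ ≤ κ * s ^ (-(δ * γ)) * s ^ (δ * (γ - 1)) := by
          refine mul_le_mul_of_nonneg_left ?_ (by positivity)
          exact Real.rpow_le_rpow_of_nonpos hs hst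
            (mul_nonpos_of_nonneg_of_nonpos hδ (sub_nonpos.2 hγ))
      _ = κ * s ^ (-δ) * 1 := by rw [mul_assoc, ← Real.rpow_add hs, mul_one]; ring_nf
      _ ≤ κ * s ^ (-δ) * t ^ (-(δ * γ)) := by
          gcongr
          exact Real.one_le_rpow_of_pos_of_le_one_of_nonpos ht ht1 (by linarith)
  · calc markFactor κ δ γ s t = κ * t ^ (-(δ * γ)) * s ^ (δ * (γ - 1)) := markFactor_of_ge hts
      _ ≤ κ * t ^ (-(δ * γ)) * s ^ (-δ) := by
          gcongr ?_ * ?_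
          exact Real.rpow_le_rpow_of_exponent_ge hs hs1 (by linarith)
      _ = κ * s ^ (-δ) * t ^ (-(δ * γ)) := by ring

theorem edgeFactor_eq (hκ : 0 < κ) (x y : Vertex d) :
    edgeFactor κ δ γ x y = ENNReal.ofReal (markFactor κ δ γ x.2 y.2)
      * ENNReal.ofReal ‖x.1 - y.1‖ ^ (-(δ * (d : ℝ))) := by
  have hmin : 0 < min (x.2 : ℝ) (y.2 : ℝ) := lt_min x.2.2.1 y.2.2.1
  have hmax : 0 < max (x.2 : ℝ) (y.2 : ℝ) := lt_max_of_lt_left x.2.2.1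
  rw [edgeFactor, markFactor, ENNReal.ofReal_rpow_of_pos hmin, ENNReal.ofReal_rpow_of_pos hmax,
    ← ENNReal.ofReal_mul hκ.le, ← ENNReal.ofReal_mul (by positivity)]

theorem edgeFactor_mono {γ' : ℝ} (hκ : 0 < κ) (hδ : 0 ≤ δ) (hγ : γ ≤ γ') (x y : Vertex d) :
    edgeFactor κ δ γ x y ≤ edgeFactor κ δ γ' x y := by
  rw [edgeFactor_eq hκ, edgeFactor_eq hκ]
  gcongr
  exact markFactor_mono hκ.le hδ hγ x.2.2.1 y.2.2.1

theorem edgeFactor_comm (κ δ γ : ℝ) (x y : Vertex d) :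
    edgeFactor κ δ γ x y = edgeFactor κ δ γ y x := by
  simp only [edgeFactor, min_comm (x.2 : ℝ), max_comm (x.2 : ℝ), norm_sub_rev x.1]

theorem edgeFactor_eq_ofReal (hκ : 0 < κ) {x y : Vertex d} (h : x.1 ≠ y.1) :
    edgeFactor κ δ γ x y
      = ENNReal.ofReal (markFactor κ δ γ x.2 y.2 * ‖x.1 - y.1‖ ^ (-(δ * (d : ℝ)))) := by
  rw [edgeFactor_eq hκ, ENNReal.ofReal_rpow_of_pos (norm_pos_iff.2 (sub_ne_zero.2 h)),
    ← ENNReal.ofReal_mul (markFactor_pos hκ x.2.2.1 y.2.2.1).le]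

theorem edgeFactor_eq_top (hd : 1 ≤ d) (hδ : 0 < δ) (hκ : 0 < κ) {x y : Vertex d}
    (h : x.1 = y.1) : edgeFactor κ δ γ x y = ∞ := by
  have hexp : -(δ * (d : ℝ)) < 0 := neg_neg_of_pos (mul_pos hδ (Nat.cast_pos.2 hd))
  rw [edgeFactor_eq hκ, h, sub_self, norm_zero, ENNReal.ofReal_zero, ENNReal.zero_rpow_of_neg hexp]
  exact ENNReal.mul_top (ENNReal.ofReal_pos.2 (markFactor_pos hκ x.2.2.1 y.2.2.1)).ne'

@[fun_prop]
theorem measurable_edgeFactor {α : Type*} [MeasurableSpace α] {f g : α → Vertex d}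
    (hf : Measurable f) (hg : Measurable g) :
    Measurable fun a => edgeFactor κ δ γ (f a) (g a) := by
  unfold edgeFactor
  fun_prop

/-- The edge factor capped at `1`, the bound on the probability of a single edge. -/
noncomputable def edgeWeight (κ δ γ : ℝ) (x y : Vertex d) : ℝ≥0∞ := min 1 (edgeFactor κ δ γ x y)

@[fun_prop]
theorem measurable_edgeWeight {α : Type*} [MeasurableSpace α] {f g : α → Vertex d}
    (hf : Measurable f) (hg : Measurable g) :
    Measurable fun a => edgeWeight κ δ γ (f a) (g a) := by
  unfold edgeWeight
  fun_prop

theorem edgeWeight_comm (κ δ γ : ℝ) (x y : Vertex d) :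
    edgeWeight κ δ γ x y = edgeWeight κ δ γ y x := by
  rw [edgeWeight, edgeWeight, edgeFactor_comm]

theorem edgeWeight_le_ofReal_of_le_norm {r : ℝ} (hδ : 0 ≤ δ) (hκ : 0 < κ) (hr : 0 < r)
    {x y : Vertex d} (h : r ≤ ‖x.1 - y.1‖) :
    edgeWeight κ δ γ x y
      ≤ ENNReal.ofReal (markFactor κ δ γ x.2 y.2 * r ^ (-(δ * (d : ℝ)))) := by
  have hne : x.1 ≠ y.1 := sub_ne_zero.1 (norm_pos_iff.1 (hr.trans_le h))
  refine (min_le_right _ _).trans ?_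
  rw [edgeFactor_eq_ofReal hκ hne]
  gcongr ENNReal.ofReal (?_ * ?_)
  · exact (markFactor_pos hκ x.2.2.1 y.2.2.1).le
  · exact Real.rpow_le_rpow_of_nonpos hr h (neg_nonpos.2 (mul_nonneg hδ d.cast_nonneg))

theorem edgeWeight_le_of_markFactor_le {A : ℝ} (hκ : 0 < κ) {a u : Vertex d}
    (hA : markFactor κ δ γ a.2 u.2 ≤ A) :
    edgeWeight κ δ γ a u
      ≤ min 1 (ENNReal.ofReal A * ENNReal.ofReal ‖a.1 - u.1‖ ^ (-(δ * (d : ℝ)))) := by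
  rw [edgeWeight, edgeFactor_eq hκ]
  gcongr

end EdgeFactor

section CappedKernel

theorem min_one_rpow_mul_rpow_le {p q r : ℝ} (hr : 0 ≤ r) (hq : 0 ≤ q) (hqp : q ≤ p) :
    min 1 (ENNReal.ofReal r ^ (-p)) * ENNReal.ofReal r ^ q
      ≤ ENNReal.ofReal (2 ^ (p - q)) * ENNReal.ofReal ((1 + r) ^ (-(p - q))) := by
  have hright : ENNReal.ofReal (2 ^ (p - q)) * ENNReal.ofReal ((1 + r) ^ (-(p - q)))
      = ENNReal.ofReal (((1 + r) / 2) ^ (-(p - q))) := by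
    rw [← ENNReal.ofReal_mul (by positivity), Real.div_rpow (by positivity) zero_le_two,
      Real.rpow_neg zero_le_two, div_inv_eq_mul, mul_comm]
  rw [hright]
  rcases le_or_gt r 1 with hr1 | hr1
  · calc min 1 (ENNReal.ofReal r ^ (-p)) * ENNReal.ofReal r ^ q ≤ 1 * 1 :=
          mul_le_mul' (min_le_left _ _) (ENNReal.rpow_le_one (ENNReal.ofReal_le_one.2 hr1) hq)
      _ ≤ ENNReal.ofReal (((1 + r) / 2) ^ (-(p - q))) := by
          rw [one_mul, ENNReal.one_le_ofReal]
          exact Real.one_le_rpow_of_pos_of_le_one_of_nonpos (by positivity) (by linarith)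
            (by linarith)
  · have hr0 : 0 < r := one_pos.trans hr1
    calc min 1 (ENNReal.ofReal r ^ (-p)) * ENNReal.ofReal r ^ q
        ≤ ENNReal.ofReal r ^ (-p) * ENNReal.ofReal r ^ q := mul_le_mul' (min_le_right _ _) le_rfl
      _ = ENNReal.ofReal (r ^ (-(p - q))) := by
          rw [ENNReal.ofReal_rpow_of_pos hr0, ENNReal.ofReal_rpow_of_pos hr0,
            ← ENNReal.ofReal_mul (by positivity), ← Real.rpow_add hr0]
          ring_nf
      _ ≤ ENNReal.ofReal (((1 + r) / 2) ^ (-(p - q))) := ENNReal.ofReal_le_ofReal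
          (Real.rpow_le_rpow_of_nonpos (by positivity) (by linarith) (by linarith))

theorem ofReal_norm_inv_smul_rpow {E : Type*} [NormedAddCommGroup E] [NormedSpace ℝ E] {ρ : ℝ}
    (hρ : 0 < ρ) (p : ℝ) (z : E) :
    ENNReal.ofReal ‖ρ⁻¹ • z‖ ^ p = ENNReal.ofReal (ρ ^ (-p)) * ENNReal.ofReal ‖z‖ ^ p := by
  rw [norm_smul, norm_inv, Real.norm_of_nonneg hρ.le, ENNReal.ofReal_mul (by positivity),
    ENNReal.mul_rpow_of_ne_top ENNReal.ofReal_ne_top ENNReal.ofReal_ne_top,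
    ENNReal.ofReal_rpow_of_pos (by positivity), Real.inv_rpow hρ.le, Real.rpow_neg hρ.le]

variable {E : Type*} [NormedAddCommGroup E] [NormedSpace ℝ E] [FiniteDimensional ℝ E]
  [MeasurableSpace E] [BorelSpace E] (μ : Measure E) [μ.IsAddHaarMeasure]

theorem lintegral_min_one_norm_rpow_lt_top {p q : ℝ} (hq : 0 ≤ q)
    (hpq : Module.finrank ℝ E + q < p) :
    ∫⁻ z, min 1 (ENNReal.ofReal ‖z‖ ^ (-p)) * ENNReal.ofReal ‖z‖ ^ q ∂μ < ∞ := by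
  have hdim : (0 : ℝ) ≤ Module.finrank ℝ E := Nat.cast_nonneg _
  calc ∫⁻ z, min 1 (ENNReal.ofReal ‖z‖ ^ (-p)) * ENNReal.ofReal ‖z‖ ^ q ∂μ
      ≤ ∫⁻ z, ENNReal.ofReal (2 ^ (p - q)) * ENNReal.ofReal ((1 + ‖z‖) ^ (-(p - q))) ∂μ :=
        lintegral_mono fun z => min_one_rpow_mul_rpow_le (norm_nonneg z) hq (by linarith)
    _ = ENNReal.ofReal (2 ^ (p - q)) * ∫⁻ z, ENNReal.ofReal ((1 + ‖z‖) ^ (-(p - q))) ∂μ :=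
        lintegral_const_mul _ (by fun_prop)
    _ < ∞ := ENNReal.mul_lt_top ENNReal.ofReal_lt_top
        (finite_integral_one_add_norm (by linarith))

theorem lintegral_comp_inv_smul {f : E → ℝ≥0∞} (hf : Measurable f) {ρ : ℝ} (hρ : 0 < ρ) :
    ∫⁻ z, f (ρ⁻¹ • z) ∂μ = ENNReal.ofReal (ρ ^ Module.finrank ℝ E) * ∫⁻ z, f z ∂μ := by
  rw [← lintegral_map hf (measurable_const_smul ρ⁻¹),
    Measure.map_addHaar_smul μ (inv_ne_zero hρ.ne'), lintegral_smul_measure, smul_eq_mul,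
    inv_pow, inv_inv, abs_of_pos (by positivity)]

theorem lintegral_min_one_norm_sub_rpow {a p : ℝ} (ha : 0 < a) (hp : p ≠ 0) (q : ℝ) (x : E) :
    ∫⁻ z, min 1 (ENNReal.ofReal a * ENNReal.ofReal ‖x - z‖ ^ (-p))
        * ENNReal.ofReal ‖x - z‖ ^ q ∂μ
      = ENNReal.ofReal (a ^ ((Module.finrank ℝ E + q) / p))
        * ∫⁻ z, min 1 (ENNReal.ofReal ‖z‖ ^ (-p)) * ENNReal.ofReal ‖z‖ ^ q ∂μ := by
  set ρ : ℝ := a ^ p⁻¹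
  have hρ : 0 < ρ := Real.rpow_pos_of_pos ha _
  have hρp : ρ ^ p = a := Real.rpow_inv_rpow ha.le hp
  let F : E → ℝ≥0∞ := fun z => min 1 (ENNReal.ofReal ‖z‖ ^ (-p)) * ENNReal.ofReal ‖z‖ ^ q
  have hscale : ∀ z : E, min 1 (ENNReal.ofReal a * ENNReal.ofReal ‖z‖ ^ (-p))
      * ENNReal.ofReal ‖z‖ ^ q = ENNReal.ofReal (ρ ^ q) * F (ρ⁻¹ • z) := by
    intro z
    simp only [F]
    rw [ofReal_norm_inv_smul_rpow hρ, ofReal_norm_inv_smul_rpow hρ, neg_neg, hρp, mul_left_comm,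
      ← mul_assoc (ENNReal.ofReal (ρ ^ q)), ← ENNReal.ofReal_mul (by positivity),
      ← Real.rpow_add hρ, add_neg_cancel, Real.rpow_zero, ENNReal.ofReal_one, one_mul]
  calc ∫⁻ z, min 1 (ENNReal.ofReal a * ENNReal.ofReal ‖x - z‖ ^ (-p))
        * ENNReal.ofReal ‖x - z‖ ^ q ∂μ
      = ∫⁻ z, min 1 (ENNReal.ofReal a * ENNReal.ofReal ‖z‖ ^ (-p))
          * ENNReal.ofReal ‖z‖ ^ q ∂μ :=
        lintegral_sub_left_eq_self (fun z => min 1 (ENNReal.ofReal a * ENNReal.ofReal ‖z‖ ^ (-p))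
          * ENNReal.ofReal ‖z‖ ^ q) x
    _ = ENNReal.ofReal (ρ ^ q) * (ENNReal.ofReal (ρ ^ Module.finrank ℝ E) * ∫⁻ z, F z ∂μ) := by
        rw [lintegral_congr hscale, lintegral_const_mul _ (by fun_prop),
          lintegral_comp_inv_smul μ (by fun_prop) hρ]
    _ = ENNReal.ofReal (a ^ ((Module.finrank ℝ E + q) / p)) * ∫⁻ z, F z ∂μ := by
        rw [← mul_assoc, ← ENNReal.ofReal_mul (by positivity), ← Real.rpow_natCast,
          ← Real.rpow_add hρ, ← Real.rpow_mul ha.le, add_comm, inv_mul_eq_div]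

end CappedKernel

section VertexIntegrals

variable {d : ℕ} {κ δ γ : ℝ}

theorem setLIntegral_vertexVolume {f : Vertex d → ℝ≥0∞} (hf : Measurable f)
    (T : Set (Set.Ioo (0 : ℝ) 1)) :
    ∫⁻ u in Prod.snd ⁻¹' T, f u ∂(vertexVolume d)
      = ∫⁻ t in T, ∫⁻ z : EuclideanSpace ℝ (Fin d), f (z, t) ∂volume ∂markVolume := by
  rw [vertexVolume_eq_prod, ← Set.univ_prod, ← Measure.prod_restrict, Measure.restrict_univ,
    lintegral_prod_symm _ hf.aemeasurable]

theorem exists_lintegral_edgeWeight_mul_rpow_le (hd : 1 ≤ d) (hκ : 0 < κ) {b : ℝ} (hb : 0 ≤ b)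
    (hbδ : 1 + b < δ) :
    ∃ C : ℝ≥0∞, C ≠ ∞ ∧ ∀ (a : Vertex d) (t : Set.Ioo (0 : ℝ) 1) (A : ℝ),
      markFactor κ δ γ a.2 t ≤ A →
      ∫⁻ z, edgeWeight κ δ γ a (z, t) * ENNReal.ofReal ‖a.1 - z‖ ^ (b * d)
        ≤ C * ENNReal.ofReal (A ^ ((1 + b) / δ)) := by
  have hd₀ : (0 : ℝ) < d := Nat.cast_pos.2 hd
  have hδ : 0 < δ := by linarith
  have hexp : (Module.finrank ℝ (EuclideanSpace ℝ (Fin d)) : ℝ) + b * d < δ * d := by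
    rw [finrank_euclideanSpace_fin]
    nlinarith
  refine ⟨_, (lintegral_min_one_norm_rpow_lt_top
    (volume : Measure (EuclideanSpace ℝ (Fin d))) (by positivity) hexp).ne, fun a t A hA => ?_⟩
  have hA₀ : 0 < A := (markFactor_pos hκ a.2.2.1 t.2.1).trans_le hA
  calc ∫⁻ z, edgeWeight κ δ γ a (z, t) * ENNReal.ofReal ‖a.1 - z‖ ^ (b * d)
      ≤ ∫⁻ z, min 1 (ENNReal.ofReal A * ENNReal.ofReal ‖a.1 - z‖ ^ (-(δ * (d : ℝ))))
          * ENNReal.ofReal ‖a.1 - z‖ ^ (b * d) :=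
        lintegral_mono fun z => mul_le_mul' (edgeWeight_le_of_markFactor_le hκ hA) le_rfl
    _ = _ := by
        rw [lintegral_min_one_norm_sub_rpow volume hA₀ (by positivity), mul_comm,
          finrank_euclideanSpace_fin, ← one_add_mul, add_mul, one_mul, ← one_add_mul,
          mul_div_mul_right _ _ hd₀.ne']

theorem setLIntegral_markVolume {S : Set ℝ} (hS : MeasurableSet S) (f : ℝ → ℝ≥0∞) :
    ∫⁻ t in Subtype.val ⁻¹' S, f t ∂markVolume = ∫⁻ t in S ∩ Set.Ioo 0 1, f t := by
  rw [← lintegral_indicator (measurable_subtype_coe hS), ← Measure.restrict_restrict hS,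
    ← lintegral_indicator hS, ← lintegral_markVolume]
  rfl

theorem setLIntegral_Iic_rpow_le {e M : ℝ} (he : e < 1) (hM : 0 < M) :
    ∫⁻ t : Set.Ioo (0 : ℝ) 1 in Subtype.val ⁻¹' Set.Iic M, ENNReal.ofReal ((t : ℝ) ^ (-e))
      ∂markVolume ≤ ENNReal.ofReal (M ^ (1 - e) / (1 - e)) := by
  calc ∫⁻ t : Set.Ioo (0 : ℝ) 1 in Subtype.val ⁻¹' Set.Iic M, ENNReal.ofReal ((t : ℝ) ^ (-e))
        ∂markVolume
      = ∫⁻ t in Set.Iic M ∩ Set.Ioo 0 1, ENNReal.ofReal (t ^ (-e)) :=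
        setLIntegral_markVolume measurableSet_Iic fun t => ENNReal.ofReal (t ^ (-e))
    _ ≤ ∫⁻ t in Set.Ioc 0 M, ENNReal.ofReal (t ^ (-e)) :=
        lintegral_mono_set fun t ht => ⟨ht.2.1, ht.1⟩
    _ = ENNReal.ofReal (∫ t in Set.Ioc 0 M, t ^ (-e)) := by
        refine (ofReal_integral_eq_lintegral_ofReal ?_ ?_).symm
        · exact (intervalIntegrable_iff_integrableOn_Ioc_of_le hM.le).1
            (intervalIntegral.intervalIntegrable_rpow' (by linarith))
        · filter_upwards [ae_restrict_mem measurableSet_Ioc] with t ht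
          exact Real.rpow_nonneg ht.1.le _
    _ = ENNReal.ofReal (M ^ (1 - e) / (1 - e)) := by
        rw [← intervalIntegral.integral_of_le hM.le, integral_rpow (Or.inl (by linarith)),
          Real.zero_rpow (by linarith), sub_zero, neg_add_eq_sub]

theorem setLIntegral_Ici_rpow_le {e M : ℝ} (he : 1 < e) (hM : 0 < M) :
    ∫⁻ t : Set.Ioo (0 : ℝ) 1 in Subtype.val ⁻¹' Set.Ici M, ENNReal.ofReal ((t : ℝ) ^ (-e))
      ∂markVolume ≤ ENNReal.ofReal (M ^ (1 - e) / (e - 1)) := by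
  calc ∫⁻ t : Set.Ioo (0 : ℝ) 1 in Subtype.val ⁻¹' Set.Ici M, ENNReal.ofReal ((t : ℝ) ^ (-e))
        ∂markVolume
      = ∫⁻ t in Set.Ici M ∩ Set.Ioo 0 1, ENNReal.ofReal (t ^ (-e)) :=
        setLIntegral_markVolume measurableSet_Ici fun t => ENNReal.ofReal (t ^ (-e))
    _ ≤ ∫⁻ t in Set.Ici M, ENNReal.ofReal (t ^ (-e)) := lintegral_mono_set Set.inter_subset_left
    _ = ENNReal.ofReal (∫ t in Set.Ioi M, t ^ (-e)) := by
        rw [← restrict_Ioi_eq_restrict_Ici]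
        refine (ofReal_integral_eq_lintegral_ofReal ?_ ?_).symm
        · exact integrableOn_Ioi_rpow_of_lt (by linarith) hM
        · filter_upwards [ae_restrict_mem measurableSet_Ioi] with t ht
          exact Real.rpow_nonneg (hM.trans ht).le _
    _ = ENNReal.ofReal (M ^ (1 - e) / (e - 1)) := by
        rw [integral_Ioi_rpow_of_lt (by linarith) hM, neg_add_eq_sub, ← neg_div_neg_eq, neg_neg,
          neg_sub]

end VertexIntegrals

section Connectors

variable {d : ℕ} {κ δ γ : ℝ}

theorem rpow_mul_rpow_le_min_mul_max {s t p q : ℝ} (hs : 0 < s) (ht : 0 < t) (hqp : q ≤ p) :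
    s ^ (-p) * t ^ (-q) ≤ min s t ^ (-p) * max s t ^ (-q) := by
  rcases le_total s t with h | h
  · rw [min_eq_left h, max_eq_right h]
  · rw [min_eq_right h, max_eq_left h]
    have hsplit : ∀ r : ℝ, 0 < r → r ^ (-p) = r ^ (-q) * r ^ (-(p - q)) := fun r hr => by
      rw [← Real.rpow_add hr]; ring_nf
    calc s ^ (-p) * t ^ (-q) = s ^ (-q) * t ^ (-q) * s ^ (-(p - q)) := by rw [hsplit s hs]; ring
      _ ≤ s ^ (-q) * t ^ (-q) * t ^ (-(p - q)) := mul_le_mul_of_nonneg_left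
          (Real.rpow_le_rpow_of_nonpos ht h (by linarith)) (by positivity)
      _ = t ^ (-p) * s ^ (-q) := by rw [hsplit t ht]; ring

theorem markFactor_rpow_div {s t : ℝ} (hκ : 0 < κ) (hδ : 0 < δ) (hs : 0 < s) (ht : 0 < t)
    (e : ℝ) : markFactor κ δ γ s t ^ (e / δ)
      = κ ^ (e / δ) * min s t ^ (-(γ * e)) * max s t ^ ((γ - 1) * e) := by
  have hmin : 0 < min s t := lt_min hs ht
  have hmax : 0 < max s t := lt_max_of_lt_left hs
  rw [markFactor, Real.mul_rpow (by positivity) (by positivity),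
    Real.mul_rpow hκ.le (by positivity), ← Real.rpow_mul hmin.le, ← Real.rpow_mul hmax.le,
    show -(δ * γ) * (e / δ) = -(γ * e) by field_simp,
    show δ * (γ - 1) * (e / δ) = (γ - 1) * e by field_simp]

theorem markFactor_mul_markFactor_rpow_le {s t v : ℝ} (hκ : 0 < κ) (hδ : 1 ≤ δ) (hγ₀ : 0 ≤ γ)
    (hs : 0 < s) (ht : 0 < t) (hsv : s ≤ v) (htv : t ≤ v) :
    markFactor κ δ γ s v * markFactor κ δ γ t v ^ (1 / δ)
      ≤ κ ^ (1 / δ) * markFactor κ δ γ s t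
        * (max s t ^ ((1 - γ) * (1 + δ) - 1) * v ^ (-((1 - γ) * (1 + δ)))) := by
  have hv : 0 < v := hs.trans_le hsv
  have hmax : 0 < max s t := lt_max_of_lt_left hs
  calc markFactor κ δ γ s v * markFactor κ δ γ t v ^ (1 / δ)
      = κ ^ (1 / δ) * κ * (v ^ (δ * (γ - 1)) * v ^ ((γ - 1) * 1))
          * (s ^ (-(δ * γ)) * t ^ (-γ)) := by
        rw [markFactor_rpow_div hκ (by linarith) ht hv, markFactor_of_le hsv, min_eq_left htv,
          max_eq_right htv, mul_one γ]
        ring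
    _ ≤ κ ^ (1 / δ) * κ * (v ^ (δ * (γ - 1)) * v ^ ((γ - 1) * 1))
          * (min s t ^ (-(δ * γ)) * max s t ^ (-γ)) := mul_le_mul_of_nonneg_left
        (rpow_mul_rpow_le_min_mul_max hs ht (le_mul_of_one_le_left hγ₀ hδ)) (by positivity)
    _ = κ ^ (1 / δ) * κ * v ^ (-((1 - γ) * (1 + δ))) * (min s t ^ (-(δ * γ))
          * (max s t ^ (δ * (γ - 1)) * max s t ^ ((1 - γ) * (1 + δ) - 1))) := by
        rw [← Real.rpow_add hv, ← Real.rpow_add hmax]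
        ring_nf
    _ = _ := by rw [markFactor]; ring

theorem edgeWeight_mul_edgeWeight_le (hκ : 0 < κ) (hδ : 0 ≤ δ) {a b : Vertex d} (hab : a.1 ≠ b.1)
    (u : Vertex d) :
    edgeWeight κ δ γ a u * edgeWeight κ δ γ u b
      ≤ ENNReal.ofReal (markFactor κ δ γ a.2 u.2 * (‖a.1 - b.1‖ / 2) ^ (-(δ * (d : ℝ))))
          * edgeWeight κ δ γ b u
        + ENNReal.ofReal (markFactor κ δ γ b.2 u.2 * (‖a.1 - b.1‖ / 2) ^ (-(δ * (d : ℝ))))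
          * edgeWeight κ δ γ a u := by
  have hD : 0 < ‖a.1 - b.1‖ := norm_pos_iff.2 (sub_ne_zero.2 hab)
  have htri : ‖a.1 - b.1‖ ≤ ‖a.1 - u.1‖ + ‖b.1 - u.1‖ :=
    norm_sub_rev b.1 u.1 ▸ norm_sub_le_norm_sub_add_norm_sub a.1 u.1 b.1
  rw [edgeWeight_comm κ δ γ u b]
  rcases le_or_gt (‖a.1 - b.1‖ / 2) ‖a.1 - u.1‖ with hau | hau
  · exact (mul_le_mul' (edgeWeight_le_ofReal_of_le_norm hδ hκ (half_pos hD) hau) le_rfl).trans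
      le_self_add
  · rw [mul_comm]
    exact (mul_le_mul' (edgeWeight_le_ofReal_of_le_norm hδ hκ (half_pos hD) (by linarith))
      le_rfl).trans le_add_self

theorem ofReal_markFactor_mul_markFactor_rpow_le (hκ : 0 < κ) (hδ : 1 ≤ δ) (hγ₀ : 0 ≤ γ)
    {a b : Vertex d} {v : Set.Ioo (0 : ℝ) 1} (hab : a.1 ≠ b.1) (hav : a.2 ≤ v) (hbv : b.2 ≤ v) :
    ENNReal.ofReal (markFactor κ δ γ a.2 v * (‖a.1 - b.1‖ / 2) ^ (-(δ * (d : ℝ))))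
        * ENNReal.ofReal (markFactor κ δ γ b.2 v ^ (1 / δ))
      ≤ ENNReal.ofReal (κ ^ (1 / δ) * 2 ^ (δ * d)) * edgeFactor κ δ γ a b
        * ENNReal.ofReal (max (a.2 : ℝ) b.2 ^ ((1 - γ) * (1 + δ) - 1)
          * (v : ℝ) ^ (-((1 - γ) * (1 + δ)))) := by
  have ha := markFactor_pos (δ := δ) (γ := γ) hκ a.2.2.1 v.2.1
  have hab₀ := markFactor_pos (δ := δ) (γ := γ) hκ a.2.2.1 b.2.2.1
  rw [edgeFactor_eq_ofReal hκ hab, ← ENNReal.ofReal_mul (by positivity),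
    ← ENNReal.ofReal_mul (by positivity), ← ENNReal.ofReal_mul (by positivity)]
  refine ENNReal.ofReal_le_ofReal ?_
  calc _ = 2 ^ (δ * d) * ‖a.1 - b.1‖ ^ (-(δ * (d : ℝ)))
          * (markFactor κ δ γ a.2 v * markFactor κ δ γ b.2 v ^ (1 / δ)) := by
        rw [Real.div_rpow (norm_nonneg _) zero_le_two, Real.rpow_neg zero_le_two, div_inv_eq_mul]
        ring
    _ ≤ 2 ^ (δ * d) * ‖a.1 - b.1‖ ^ (-(δ * (d : ℝ))) * (κ ^ (1 / δ) * markFactor κ δ γ a.2 b.2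
          * (max (a.2 : ℝ) b.2 ^ ((1 - γ) * (1 + δ) - 1)
            * (v : ℝ) ^ (-((1 - γ) * (1 + δ))))) := mul_le_mul_of_nonneg_left
        (markFactor_mul_markFactor_rpow_le hκ hδ hγ₀ a.2.2.1 b.2.2.1 hav hbv) (by positivity)
    _ = _ := by ring

theorem exists_lintegral_edgeWeight_le (hd : 1 ≤ d) (hκ : 0 < κ) (hδ : 1 < δ) :
    ∃ C : ℝ≥0∞, C ≠ ∞ ∧ ∀ (a : Vertex d) (t : Set.Ioo (0 : ℝ) 1) (A : ℝ),
      markFactor κ δ γ a.2 t ≤ A →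
      ∫⁻ z, edgeWeight κ δ γ a (z, t) ≤ C * ENNReal.ofReal (A ^ (1 / δ)) := by
  simpa using exists_lintegral_edgeWeight_mul_rpow_le (γ := γ) hd hκ le_rfl
    (by linarith : 1 + 0 < δ)

theorem exists_lintegral_connector_at_mark_le (hd : 1 ≤ d) (hκ : 0 < κ) (hδ : 1 < δ)
    (hγ₀ : 0 ≤ γ) :
    ∃ C : ℝ≥0∞, C ≠ ∞ ∧ ∀ (a b : Vertex d) (v : Set.Ioo (0 : ℝ) 1),
      a.1 ≠ b.1 → a.2 ≤ v → b.2 ≤ v →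
      ∫⁻ z, edgeWeight κ δ γ a (z, v) * edgeWeight κ δ γ (z, v) b
        ≤ C * edgeFactor κ δ γ a b * ENNReal.ofReal (max (a.2 : ℝ) b.2 ^ ((1 - γ) * (1 + δ) - 1)
          * (v : ℝ) ^ (-((1 - γ) * (1 + δ)))) := by
  obtain ⟨C, hC, hloc⟩ := exists_lintegral_edgeWeight_le (γ := γ) hd hκ hδ
  refine ⟨2 * (C * ENNReal.ofReal (κ ^ (1 / δ) * 2 ^ (δ * d))), by finiteness,
    fun a b v hab hav hbv => ?_⟩
  have hterm : ∀ x y : Vertex d, x.1 ≠ y.1 → x.2 ≤ v → y.2 ≤ v →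
      ENNReal.ofReal (markFactor κ δ γ x.2 v * (‖x.1 - y.1‖ / 2) ^ (-(δ * (d : ℝ))))
          * ∫⁻ z, edgeWeight κ δ γ y (z, v)
        ≤ C * (ENNReal.ofReal (κ ^ (1 / δ) * 2 ^ (δ * d)) * edgeFactor κ δ γ x y
          * ENNReal.ofReal (max (x.2 : ℝ) y.2 ^ ((1 - γ) * (1 + δ) - 1)
            * (v : ℝ) ^ (-((1 - γ) * (1 + δ))))) := fun x y hxy hxv hyv => by
    refine (mul_le_mul' le_rfl (hloc y v _ le_rfl)).trans ?_
    rw [mul_left_comm]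
    exact mul_le_mul' le_rfl
      (ofReal_markFactor_mul_markFactor_rpow_le hκ hδ.le hγ₀ hxy hxv hyv)
  calc ∫⁻ z, edgeWeight κ δ γ a (z, v) * edgeWeight κ δ γ (z, v) b
      ≤ ∫⁻ z, ENNReal.ofReal (markFactor κ δ γ a.2 v * (‖a.1 - b.1‖ / 2) ^ (-(δ * (d : ℝ))))
            * edgeWeight κ δ γ b (z, v)
          + ENNReal.ofReal (markFactor κ δ γ b.2 v * (‖a.1 - b.1‖ / 2) ^ (-(δ * (d : ℝ))))
            * edgeWeight κ δ γ a (z, v) :=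
        lintegral_mono fun z => edgeWeight_mul_edgeWeight_le hκ (by linarith) hab (z, v)
    _ = ENNReal.ofReal (markFactor κ δ γ a.2 v * (‖a.1 - b.1‖ / 2) ^ (-(δ * (d : ℝ))))
            * (∫⁻ z, edgeWeight κ δ γ b (z, v))
          + ENNReal.ofReal (markFactor κ δ γ b.2 v * (‖b.1 - a.1‖ / 2) ^ (-(δ * (d : ℝ))))
            * ∫⁻ z, edgeWeight κ δ γ a (z, v) := by
        rw [lintegral_add_left (by fun_prop), lintegral_const_mul _ (by fun_prop),
          lintegral_const_mul _ (by fun_prop), norm_sub_rev b.1]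
    _ ≤ _ := add_le_add (hterm a b hab hav hbv) (hterm b a hab.symm hbv hav)
    _ = _ := by rw [edgeFactor_comm κ δ γ b a, max_comm (b.2 : ℝ)]; ring

theorem exists_lintegral_connector_le (hd : 1 ≤ d) (hκ : 0 < κ) (hδ : 1 < δ) (hγ₀ : 0 ≤ γ)
    (hγ : γ < δ / (δ + 1)) :
    ∃ K : ℝ≥0∞, K ≠ ∞ ∧ ∀ a b : Vertex d,
      ∫⁻ u in Prod.snd ⁻¹' Set.Ici (max a.2 b.2), edgeWeight κ δ γ a u * edgeWeight κ δ γ u b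
        ∂(vertexVolume d) ≤ K * edgeFactor κ δ γ a b := by
  obtain ⟨C, hC, hmark⟩ := exists_lintegral_connector_at_mark_le hd hκ hδ hγ₀
  set e : ℝ := (1 - γ) * (1 + δ) with he
  -- `γ < δ / (δ + 1)` says precisely that the integral over the mark of the connector converges.
  have he1 : 1 < e := by
    have := (lt_div_iff₀ (by linarith)).1 hγ
    rw [he]; linarith
  refine ⟨C * ENNReal.ofReal (e - 1)⁻¹ + 1, by finiteness, fun a b => ?_⟩
  by_cases hab : a.1 = b.1
  · rw [edgeFactor_eq_top hd (by linarith) hκ hab, ENNReal.mul_top (by simp)]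
    exact le_top
  set m : ℝ := max (a.2 : ℝ) b.2
  have hm : 0 < m := lt_max_of_lt_left a.2.2.1
  have hset : Set.Ici (max a.2 b.2) = Subtype.val ⁻¹' Set.Ici m := by
    ext v; simp only [m, Set.mem_Ici, Set.mem_preimage, max_le_iff, Subtype.coe_le_coe]
  calc ∫⁻ u in Prod.snd ⁻¹' Set.Ici (max a.2 b.2), edgeWeight κ δ γ a u * edgeWeight κ δ γ u b
        ∂(vertexVolume d)
      = ∫⁻ v in Set.Ici (max a.2 b.2), ∫⁻ z : EuclideanSpace ℝ (Fin d),
          edgeWeight κ δ γ a (z, v) * edgeWeight κ δ γ (z, v) b ∂volume ∂markVolume :=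
        setLIntegral_vertexVolume (by fun_prop) _
    _ ≤ ∫⁻ v in Set.Ici (max a.2 b.2), C * edgeFactor κ δ γ a b * ENNReal.ofReal (m ^ (e - 1))
          * ENNReal.ofReal ((v : ℝ) ^ (-e)) ∂markVolume := by
        refine setLIntegral_mono (by fun_prop) fun v hv => ?_
        rw [mul_assoc, ← ENNReal.ofReal_mul (by positivity)]
        exact hmark a b v hab ((le_max_left _ _).trans hv) ((le_max_right _ _).trans hv)
    _ ≤ C * edgeFactor κ δ γ a b * ENNReal.ofReal (m ^ (e - 1))
          * ENNReal.ofReal (m ^ (1 - e) / (e - 1)) := by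
        rw [lintegral_const_mul _ (by fun_prop), hset]
        gcongr
        exact setLIntegral_Ici_rpow_le he1 hm
    _ = C * ENNReal.ofReal (e - 1)⁻¹ * edgeFactor κ δ γ a b := by
        rw [mul_assoc, ← ENNReal.ofReal_mul (by positivity), ← mul_div_assoc, ← Real.rpow_add hm,
          sub_add_sub_cancel', sub_self, Real.rpow_zero, one_div, mul_right_comm]
    _ ≤ (C * ENNReal.ofReal (e - 1)⁻¹ + 1) * edgeFactor κ δ γ a b := by
        gcongr; exact le_self_add

end Connectors

section Reach

variable {d : ℕ} {κ δ γ b : ℝ}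

/-- A weight of the vertex `u` that is large if `u` is far from `x` or has a small mark. -/
noncomputable def reach (b : ℝ) (x : EuclideanSpace ℝ (Fin d)) (u : Vertex d) : ℝ≥0∞ :=
  ENNReal.ofReal ‖x - u.1‖ ^ (b * d) + ENNReal.ofReal ((u.2 : ℝ) ^ (-b))

@[fun_prop]
theorem measurable_reach {α : Type*} [MeasurableSpace α] {x : EuclideanSpace ℝ (Fin d)}
    {f : α → Vertex d} (hf : Measurable f) : Measurable fun a => reach b x (f a) := by
  unfold reach
  fun_prop

theorem ofReal_norm_sub_rpow_le {q : ℝ} (hq : 0 ≤ q) (hq1 : q ≤ 1) {E : Type*}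
    [SeminormedAddCommGroup E] (x y z : E) :
    ENNReal.ofReal ‖x - z‖ ^ q ≤ ENNReal.ofReal ‖x - y‖ ^ q + ENNReal.ofReal ‖y - z‖ ^ q :=
  calc ENNReal.ofReal ‖x - z‖ ^ q ≤ (ENNReal.ofReal ‖x - y‖ + ENNReal.ofReal ‖y - z‖) ^ q := by
        rw [← ENNReal.ofReal_add (norm_nonneg _) (norm_nonneg _)]
        gcongr
        exact norm_sub_le_norm_sub_add_norm_sub x y z
    _ ≤ _ := ENNReal.rpow_add_le_add_rpow _ _ hq hq1

theorem exists_lintegral_edgeWeight_mul_reach_at_mark_le (hd : 1 ≤ d) (hκ : 0 < κ) (hδ : 1 < δ)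
    (hb : 0 ≤ b) (hbd : b * d ≤ 1) (hbδ : 1 + b < δ) :
    ∃ C : ℝ≥0∞, C ≠ ∞ ∧ ∀ (x : EuclideanSpace ℝ (Fin d)) (a : Vertex d) (t : Set.Ioo (0 : ℝ) 1)
      (A : ℝ), markFactor κ δ γ a.2 t ≤ A →
      ∫⁻ z, edgeWeight κ δ γ a (z, t) * reach b x (z, t)
        ≤ C * (ENNReal.ofReal (A ^ (1 / δ)) * reach b x (a.1, t)
          + ENNReal.ofReal (A ^ ((1 + b) / δ))) := by
  obtain ⟨C₁, hC₁, hloc⟩ := exists_lintegral_edgeWeight_le (γ := γ) hd hκ hδ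
  obtain ⟨C₂, hC₂, hmoment⟩ := exists_lintegral_edgeWeight_mul_rpow_le (γ := γ) hd hκ hb hbδ
  refine ⟨C₁ + C₂, by finiteness, fun x a t A hA => ?_⟩
  have hreach : ∀ z, reach b x (z, t)
      ≤ reach b x (a.1, t) + ENNReal.ofReal ‖a.1 - z‖ ^ (b * d) := fun z => by
    rw [reach, reach, add_right_comm]
    gcongr
    exact ofReal_norm_sub_rpow_le (by positivity) hbd x a.1 z
  calc ∫⁻ z, edgeWeight κ δ γ a (z, t) * reach b x (z, t)
      ≤ ∫⁻ z, (edgeWeight κ δ γ a (z, t) * reach b x (a.1, t)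
          + edgeWeight κ δ γ a (z, t) * ENNReal.ofReal ‖a.1 - z‖ ^ (b * d)) :=
        lintegral_mono fun z => (mul_le_mul' le_rfl (hreach z)).trans_eq (mul_add _ _ _)
    _ = (∫⁻ z, edgeWeight κ δ γ a (z, t)) * reach b x (a.1, t)
          + ∫⁻ z, edgeWeight κ δ γ a (z, t) * ENNReal.ofReal ‖a.1 - z‖ ^ (b * d) := by
        rw [lintegral_add_left (by fun_prop), lintegral_mul_const _ (by fun_prop)]
    _ ≤ C₁ * ENNReal.ofReal (A ^ (1 / δ)) * reach b x (a.1, t)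
          + C₂ * ENNReal.ofReal (A ^ ((1 + b) / δ)) := by
        gcongr
        exacts [hloc a t A hA, hmoment a t A hA]
    _ ≤ (C₁ + C₂) * ENNReal.ofReal (A ^ (1 / δ)) * reach b x (a.1, t)
          + (C₁ + C₂) * ENNReal.ofReal (A ^ ((1 + b) / δ)) := by
        gcongr
        exacts [le_self_add, le_add_self]
    _ = _ := by ring

theorem ofReal_mul_rpow_mul_add {R t : ℝ} (hR : 0 ≤ R) (ht : 0 < t) (X : ℝ≥0∞) :
    ENNReal.ofReal (R * t ^ (-γ)) * (X + ENNReal.ofReal (t ^ (-b)))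
        + ENNReal.ofReal ((R * t ^ (-γ)) ^ (1 + b))
      = ENNReal.ofReal R * X * ENNReal.ofReal (t ^ (-γ))
        + ENNReal.ofReal R * ENNReal.ofReal (t ^ (-(γ + b)))
        + ENNReal.ofReal (R ^ (1 + b)) * ENNReal.ofReal (t ^ (-(γ * (1 + b)))) := by
  have htγ := Real.rpow_nonneg ht.le (-γ)
  rw [Real.mul_rpow hR htγ, ← Real.rpow_mul ht.le, neg_mul, neg_add, Real.rpow_add ht,
    ENNReal.ofReal_mul hR, ENNReal.ofReal_mul htγ, ENNReal.ofReal_mul (Real.rpow_nonneg hR _)]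
  ring

theorem setLIntegral_Iic_rpow_le_of_le {e e₀ : ℝ} (he : e ≤ e₀) (he₀ : e₀ < 1) {M : ℝ}
    (hM : 0 < M) :
    ∫⁻ t : Set.Ioo (0 : ℝ) 1 in Subtype.val ⁻¹' Set.Iic M, ENNReal.ofReal ((t : ℝ) ^ (-e))
        ∂markVolume
      ≤ ENNReal.ofReal (1 - e₀)⁻¹ * ENNReal.ofReal (M ^ (1 - e)) := by
  refine (setLIntegral_Iic_rpow_le (by linarith) hM).trans ?_
  rw [← ENNReal.ofReal_mul (inv_nonneg.2 (by linarith)), div_eq_inv_mul]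
  gcongr

theorem setLIntegral_Iic_rpow_mul_add_le (hb : 0 ≤ b) (hbγ : γ + b < 1) {M Q : ℝ} (hM : 0 < M)
    (hQ : 0 ≤ Q) (X : ℝ≥0∞) :
    ∫⁻ t : Set.Ioo (0 : ℝ) 1 in Subtype.val ⁻¹' Set.Iic M,
        (ENNReal.ofReal (Q * M ^ (γ - 1) * (t : ℝ) ^ (-γ)) * (X + ENNReal.ofReal ((t : ℝ) ^ (-b)))
          + ENNReal.ofReal ((Q * M ^ (γ - 1) * (t : ℝ) ^ (-γ)) ^ (1 + b))) ∂markVolume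
      ≤ ENNReal.ofReal (1 - (γ + b))⁻¹
        * (ENNReal.ofReal (Q + Q ^ (1 + b)) * (X + ENNReal.ofReal (M ^ (-b)))) := by
  set c : ℝ≥0∞ := ENNReal.ofReal (1 - (γ + b))⁻¹
  set R : ℝ := Q * M ^ (γ - 1) with hR_def
  have hR : 0 ≤ R := by positivity
  have hpow := fun e he => setLIntegral_Iic_rpow_le_of_le (e := e) he hbγ hM
  have hRM : ∀ e, R * M ^ (1 - γ + e) = Q * M ^ e := fun e => by
    rw [hR_def, mul_assoc, ← Real.rpow_add hM, ← add_assoc, sub_add_sub_cancel, sub_self, zero_add]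
  have hRM₁ : R ^ (1 + b) * M ^ (1 - γ * (1 + b)) = Q ^ (1 + b) * M ^ (-b) := by
    rw [hR_def, Real.mul_rpow hQ (by positivity), ← Real.rpow_mul hM.le, mul_assoc,
      ← Real.rpow_add hM]
    congr 2
    ring
  rw [lintegral_congr fun t => ofReal_mul_rpow_mul_add hR t.2.1 X,
    lintegral_add_left (by fun_prop), lintegral_add_left (by fun_prop),
    lintegral_const_mul _ (by fun_prop), lintegral_const_mul _ (by fun_prop),
    lintegral_const_mul _ (by fun_prop)]
  calc _ ≤ ENNReal.ofReal R * X * (c * ENNReal.ofReal (M ^ (1 - γ)))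
          + ENNReal.ofReal R * (c * ENNReal.ofReal (M ^ (1 - (γ + b))))
          + ENNReal.ofReal (R ^ (1 + b)) * (c * ENNReal.ofReal (M ^ (1 - γ * (1 + b)))) := by
        gcongr
        exacts [hpow _ (by linarith), hpow _ le_rfl, hpow _ (by nlinarith)]
    _ = c * (ENNReal.ofReal (R * M ^ (1 - γ + 0)) * X + ENNReal.ofReal (R * M ^ (1 - γ + -b))
          + ENNReal.ofReal (R ^ (1 + b) * M ^ (1 - γ * (1 + b)))) := by
        rw [add_zero, ← sub_eq_add_neg, sub_sub]
        simp only [ENNReal.ofReal_mul hR, ENNReal.ofReal_mul (Real.rpow_nonneg hR _)]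
        ring
    _ = c * (ENNReal.ofReal Q * (X + ENNReal.ofReal (M ^ (-b)))
          + ENNReal.ofReal (Q ^ (1 + b)) * ENNReal.ofReal (M ^ (-b))) := by
        rw [hRM, hRM, hRM₁, Real.rpow_zero, mul_one, ENNReal.ofReal_mul hQ,
          ENNReal.ofReal_mul (Real.rpow_nonneg hQ _), mul_add (ENNReal.ofReal Q)]
    _ ≤ c * (ENNReal.ofReal Q * (X + ENNReal.ofReal (M ^ (-b)))
          + ENNReal.ofReal (Q ^ (1 + b)) * (X + ENNReal.ofReal (M ^ (-b)))) :=
        mul_le_mul' le_rfl (add_le_add le_rfl (mul_le_mul' le_rfl le_add_self))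
    _ = _ := by rw [ENNReal.ofReal_add hQ (Real.rpow_nonneg hQ _), add_mul]

theorem exists_setLIntegral_edgeWeight_mul_reach_le (hd : 1 ≤ d) (hκ : 0 < κ) (hδ : 1 < δ)
    (hb : 0 ≤ b) (hbd : b * d ≤ 1) (hbδ : 1 + b < δ) (hbγ : γ + b < 1) :
    ∃ C : ℝ≥0∞, C ≠ ∞ ∧ ∀ (x : EuclideanSpace ℝ (Fin d)) (a : Vertex d) (M Q : ℝ), 0 < M → 0 ≤ Q →
      (∀ t : Set.Ioo (0 : ℝ) 1, (t : ℝ) ≤ M →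
        markFactor κ δ γ a.2 t ≤ (Q * M ^ (γ - 1) * (t : ℝ) ^ (-γ)) ^ δ) →
      ∫⁻ u in Prod.snd ⁻¹' (Subtype.val ⁻¹' Set.Iic M), edgeWeight κ δ γ a u * reach b x u
          ∂(vertexVolume d)
        ≤ C * (ENNReal.ofReal (Q + Q ^ (1 + b))
          * (ENNReal.ofReal ‖x - a.1‖ ^ (b * d) + ENNReal.ofReal (M ^ (-b)))) := by
  have hδ₀ : δ ≠ 0 := by linarith
  obtain ⟨C, hC, hmark⟩ :=
    exists_lintegral_edgeWeight_mul_reach_at_mark_le (γ := γ) hd hκ hδ hb hbd hbδ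
  refine ⟨C * ENNReal.ofReal (1 - (γ + b))⁻¹, by finiteness, fun x a M Q hM hQ hfactor => ?_⟩
  have hstrip : MeasurableSet (Subtype.val ⁻¹' Set.Iic M : Set (Set.Ioo (0 : ℝ) 1)) :=
    measurable_subtype_coe measurableSet_Iic
  calc ∫⁻ u in Prod.snd ⁻¹' (Subtype.val ⁻¹' Set.Iic M), edgeWeight κ δ γ a u * reach b x u
        ∂(vertexVolume d)
      = ∫⁻ t in Subtype.val ⁻¹' Set.Iic M, ∫⁻ z : EuclideanSpace ℝ (Fin d),
          edgeWeight κ δ γ a (z, t) * reach b x (z, t) ∂volume ∂markVolume :=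
        setLIntegral_vertexVolume (by fun_prop) _
    _ ≤ ∫⁻ t : Set.Ioo (0 : ℝ) 1 in Subtype.val ⁻¹' Set.Iic M,
          C * (ENNReal.ofReal (Q * M ^ (γ - 1) * (t : ℝ) ^ (-γ))
            * (ENNReal.ofReal ‖x - a.1‖ ^ (b * d) + ENNReal.ofReal ((t : ℝ) ^ (-b)))
          + ENNReal.ofReal ((Q * M ^ (γ - 1) * (t : ℝ) ^ (-γ)) ^ (1 + b))) ∂markVolume := by
        refine setLIntegral_mono (by fun_prop) fun t ht =>
          (hmark x a t _ (hfactor t ht)).trans_eq ?_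
        have ht₀ := t.2.1
        rw [← Real.rpow_mul (by positivity), ← Real.rpow_mul (by positivity),
          mul_div_cancel₀ _ hδ₀, mul_div_cancel₀ _ hδ₀, Real.rpow_one, reach]
    _ ≤ _ := by
        rw [lintegral_const_mul _ (by fun_prop), mul_assoc C]
        gcongr
        exact setLIntegral_Iic_rpow_mul_add_le hb hbγ hM hQ _

theorem exists_lintegral_stronger_reach_le (hd : 1 ≤ d) (hκ : 0 < κ) (hδ : 1 < δ)
    (hb : 0 ≤ b) (hbd : b * d ≤ 1) (hbδ : 1 + b < δ) (hbγ : γ + b < 1) :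
    ∃ C : ℝ≥0∞, C ≠ ∞ ∧ ∀ (x : EuclideanSpace ℝ (Fin d)) (a : Vertex d),
      ∫⁻ u in Prod.snd ⁻¹' Set.Iic a.2, edgeWeight κ δ γ a u * reach b x u ∂(vertexVolume d)
        ≤ C * reach b x a := by
  obtain ⟨C, hC, hstrip⟩ :=
    exists_setLIntegral_edgeWeight_mul_reach_le (γ := γ) hd hκ hδ hb hbd hbδ hbγ
  refine ⟨C * ENNReal.ofReal (κ ^ δ⁻¹ + (κ ^ δ⁻¹) ^ (1 + b)), by finiteness, fun x a => ?_⟩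
  have hfactor : ∀ t : Set.Ioo (0 : ℝ) 1, (t : ℝ) ≤ a.2 →
      markFactor κ δ γ a.2 t ≤ (κ ^ δ⁻¹ * (a.2 : ℝ) ^ (γ - 1) * (t : ℝ) ^ (-γ)) ^ δ := by
    intro t ht
    have ha₀ := a.2.2.1
    have ht₀ := t.2.1
    rw [Real.mul_rpow (by positivity) (by positivity),
      Real.mul_rpow (by positivity) (by positivity), Real.rpow_inv_rpow hκ.le (by linarith),
      ← Real.rpow_mul ha₀.le, ← Real.rpow_mul ht₀.le,
      markFactor_of_ge ht, mul_right_comm]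
    exact le_of_eq (by ring_nf)
  rw [mul_assoc]
  exact hstrip x a a.2 _ a.2.2.1 (by positivity) hfactor

theorem exists_lintegral_edgeWeight_mul_reach_le (hd : 1 ≤ d) (hκ : 0 < κ) (hδ : 1 < δ)
    (hγ₀ : 0 ≤ γ) (hb : 0 < b) (hbd : b * d ≤ 1) (hbδ : 1 + b < δ) (hbγ : γ + b < 1)
    (s : Set.Ioo (0 : ℝ) 1) :
    ∃ C : ℝ≥0∞, C ≠ ∞ ∧ ∀ x : EuclideanSpace ℝ (Fin d),
      ∫⁻ u, edgeWeight κ δ γ (x, s) u * reach b x u ∂(vertexVolume d) ≤ C := by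
  obtain ⟨C, hC, hstrip⟩ :=
    exists_setLIntegral_edgeWeight_mul_reach_le (γ := γ) hd hκ hδ hb.le hbd hbδ hbγ
  have hs := s.2.1
  set Q : ℝ := κ ^ δ⁻¹ * (s : ℝ) ^ (-1 : ℝ)
  refine ⟨C * ENNReal.ofReal (Q + Q ^ (1 + b)), by finiteness, fun x => ?_⟩
  have hfactor : ∀ t : Set.Ioo (0 : ℝ) 1, (t : ℝ) ≤ 1 →
      markFactor κ δ γ s t ≤ (Q * 1 ^ (γ - 1) * (t : ℝ) ^ (-γ)) ^ δ := by
    intro t ht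
    have ht₀ := t.2.1
    rw [Real.one_rpow, mul_one, Real.mul_rpow (by positivity) (by positivity),
      Real.mul_rpow (by positivity) (by positivity), Real.rpow_inv_rpow hκ.le (by linarith),
      ← Real.rpow_mul hs.le, ← Real.rpow_mul ht₀.le, neg_one_mul, neg_mul, mul_comm γ]
    exact markFactor_le hκ.le (by linarith) hγ₀ (by linarith) hs s.2.2.le ht₀ ht
  have hall : Prod.snd ⁻¹' (Subtype.val ⁻¹' Set.Iic (1 : ℝ)) = (Set.univ : Set (Vertex d)) :=
    Set.eq_univ_of_forall fun u => u.2.2.2.le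
  have hd₀ : (0 : ℝ) < d := Nat.cast_pos.2 hd
  simpa [hall, ENNReal.zero_rpow_of_pos (mul_pos hb hd₀)] using
    hstrip x (x, s) 1 Q one_pos (by positivity) hfactor

end Reach

section TreeLabellings

variable {α : Type*} {l r : BinaryTree Unit}

/-- The nodes of a binary tree, used to index the vertices of a path that is encoded by the tree. -/
def TreeNode : BinaryTree Unit → Type
  | .nil => Empty
  | .node _ l r => Unit ⊕ (TreeNode l ⊕ TreeNode r)

instance TreeNode.instFintype : ∀ T : BinaryTree Unit, Fintype (TreeNode T)
  | .nil => inferInstanceAs (Fintype Empty)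
  | .node _ l r =>
    letI := TreeNode.instFintype l
    letI := TreeNode.instFintype r
    inferInstanceAs (Fintype (Unit ⊕ (TreeNode l ⊕ TreeNode r)))

instance TreeNode.instIsEmpty : IsEmpty (TreeNode .nil) := inferInstanceAs (IsEmpty Empty)

/-- The label of the root of a labelled tree. -/
def rootLabel (x : TreeNode (.node () l r) → α) : α :=
  x (Sum.inl ())

/-- The labelling of the left subtree of a labelled tree. -/
def leftLabels (x : TreeNode (.node () l r) → α) : TreeNode l → α :=
  fun j => x (Sum.inr (Sum.inl j))

/-- The labelling of the right subtree of a labelled tree. -/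
def rightLabels (x : TreeNode (.node () l r) → α) : TreeNode r → α :=
  fun j => x (Sum.inr (Sum.inr j))

/-- The labelling of a tree assembled from the label of the root and the labellings of the two
subtrees. -/
def nodeLabels (u : α) (y : TreeNode l → α) (z : TreeNode r → α) : TreeNode (.node () l r) → α :=
  Sum.elim (fun _ => u) (Sum.elim y z)

/-- The labels of a tree in symmetric order, which is the order along the path that the labelled
tree encodes. -/
def inorderLabels : (T : BinaryTree Unit) → (TreeNode T → α) → List α
  | .nil, _ => []
  | .node _ l r, x =>
    inorderLabels l (leftLabels x) ++ rootLabel x :: inorderLabels r (rightLabels x)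

theorem inorderLabels_nodeLabels (u : α) (y : TreeNode l → α) (z : TreeNode r → α) :
    inorderLabels (.node () l r) (nodeLabels u y z)
      = inorderLabels l y ++ u :: inorderLabels r z := rfl

theorem map_inorderLabels {β : Type*} (f : α → β) (T : BinaryTree Unit) (x : TreeNode T → α) :
    (inorderLabels T x).map f = inorderLabels T (f ∘ x) := by
  induction T with
  | nil => rfl
  | node _ l r ihl ihr =>
    rw [inorderLabels, List.map_append, List.map_cons, ihl, ihr]
    rfl

theorem length_inorderLabels (T : BinaryTree Unit) (x : TreeNode T → α) :
    (inorderLabels T x).length = T.numNodes := by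
  induction T with
  | nil => rfl
  | node _ l r ihl ihr =>
    rw [inorderLabels, List.length_append, List.length_cons, ihl, ihr, BinaryTree.numNodes]
    ring

theorem apply_mem_inorderLabels (T : BinaryTree Unit) (x : TreeNode T → α) (i : TreeNode T) :
    x i ∈ inorderLabels T x := by
  induction T with
  | nil => exact i.elim
  | node _ l r ihl ihr =>
    rw [inorderLabels, List.mem_append, List.mem_cons]
    rcases i with _ | i | i
    · exact Or.inr (Or.inl rfl)
    · exact Or.inl (ihl (leftLabels x) i)
    · exact Or.inr (Or.inr (ihr (rightLabels x) i))

theorem injective_of_nodup_inorderLabels {T : BinaryTree Unit} {x : TreeNode T → α}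
    (h : (inorderLabels T x).Nodup) : Function.Injective x := by
  rw [← Function.comp_id x, ← map_inorderLabels] at h
  exact fun i j hij => List.inj_on_of_nodup_map h (apply_mem_inorderLabels T id i)
    (apply_mem_inorderLabels T id j) hij

end TreeLabellings

section TreeIntegrals

variable {α : Type*} [MeasurableSpace α] {l r : BinaryTree Unit}

theorem measurable_rootLabel : Measurable (rootLabel : (TreeNode (.node () l r) → α) → α) :=
  measurable_pi_apply _

theorem measurable_leftLabels :
    Measurable (leftLabels : (TreeNode (.node () l r) → α) → TreeNode l → α) :=
  measurable_pi_lambda _ fun _ => measurable_pi_apply _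

theorem measurable_rightLabels :
    Measurable (rightLabels : (TreeNode (.node () l r) → α) → TreeNode r → α) :=
  measurable_pi_lambda _ fun _ => measurable_pi_apply _

variable (μ : Measure α) [SigmaFinite μ]

theorem lintegral_pi_sum {ι ι' : Type*} [Fintype ι] [Fintype ι'] {g : (ι ⊕ ι' → α) → ℝ≥0∞}
    (hg : Measurable g) :
    ∫⁻ x, g x ∂(Measure.pi fun _ : ι ⊕ ι' => μ)
      = ∫⁻ y, ∫⁻ z, g (Sum.elim y z) ∂(Measure.pi fun _ : ι' => μ)
          ∂(Measure.pi fun _ : ι => μ) := by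
  have h := measurePreserving_sumPiEquivProdPi_symm (X := fun _ : ι ⊕ ι' => α) fun _ => μ
  rw [← h.lintegral_comp_emb (MeasurableEquiv.measurableEmbedding _)]
  exact lintegral_prod _ (hg.comp (MeasurableEquiv.measurable _)).aemeasurable

theorem lintegral_pi_unit_sum {ι : Type*} [Fintype ι] {g : (Unit ⊕ ι → α) → ℝ≥0∞}
    (hg : Measurable g) :
    ∫⁻ x, g x ∂(Measure.pi fun _ : Unit ⊕ ι => μ)
      = ∫⁻ u, ∫⁻ z, g (Sum.elim (fun _ => u) z) ∂(Measure.pi fun _ : ι => μ) ∂μ := by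
  have h := (measurePreserving_funUnique μ Unit).symm
  rw [lintegral_pi_sum μ hg, ← h.lintegral_comp_emb (MeasurableEquiv.measurableEmbedding _)]
  rfl

theorem lintegral_nodeLabels {g : (TreeNode (.node () l r) → α) → ℝ≥0∞} (hg : Measurable g) :
    ∫⁻ x, g x ∂(Measure.pi fun _ => μ)
      = ∫⁻ u, ∫⁻ y, ∫⁻ z, g (nodeLabels u y z) ∂(Measure.pi fun _ => μ) ∂(Measure.pi fun _ => μ)
        ∂μ := by
  refine (lintegral_pi_unit_sum (ι := TreeNode l ⊕ TreeNode r) μ hg).trans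
    (lintegral_congr fun u => lintegral_pi_sum μ (hg.comp ?_))
  exact measurable_pi_lambda _ (Sum.rec (fun _ => measurable_const) measurable_pi_apply)

theorem lintegral_indicator_rootLabel {S : Set α} (hS : MeasurableSet S)
    {F : α → (TreeNode l → α) → ℝ≥0∞} {G : α → (TreeNode r → α) → ℝ≥0∞}
    (hF : Measurable F.uncurry) (hG : Measurable G.uncurry) :
    ∫⁻ x : TreeNode (.node () l r) → α,
        S.indicator (fun u => F u (leftLabels x) * G u (rightLabels x)) (rootLabel x)
          ∂(Measure.pi fun _ => μ)
      = ∫⁻ u in S, (∫⁻ y, F u y ∂(Measure.pi fun _ => μ)) * ∫⁻ z, G u z ∂(Measure.pi fun _ => μ)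
          ∂μ := by
  have hFG : Measurable fun x : TreeNode (.node () l r) → α =>
      F (rootLabel x) (leftLabels x) * G (rootLabel x) (rightLabels x) :=
    (hF.comp (measurable_rootLabel.prodMk measurable_leftLabels)).mul
      (hG.comp (measurable_rootLabel.prodMk measurable_rightLabels))
  refine (lintegral_nodeLabels μ (hFG.indicator (measurable_rootLabel hS))).trans ?_
  rw [← lintegral_indicator hS]
  refine lintegral_congr fun u => ?_
  by_cases hu : u ∈ S
  · have hmem : ∀ y z, (nodeLabels u y z : TreeNode (.node () l r) → α) ∈ rootLabel ⁻¹' S :=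
      fun _ _ => hu
    simp only [Set.indicator_of_mem hu, Set.indicator_of_mem (hmem _ _)]
    exact lintegral_lintegral_mul (hF.comp measurable_prodMk_left).aemeasurable
      (hG.comp measurable_prodMk_left).aemeasurable
  · have hnotMem : ∀ y z, (nodeLabels u y z : TreeNode (.node () l r) → α) ∉ rootLabel ⁻¹' S :=
      fun _ _ => hu
    simp only [Set.indicator_of_notMem hu, Set.indicator_of_notMem (hnotMem _ _), lintegral_zero]

end TreeIntegrals

section TreeWeights

variable {α : Type*} (w : α → α → ℝ≥0∞) (S : α → α → Set α) (U : α → Set α) (h : α → ℝ≥0∞)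

/-- The weight of a path from `a` to `b` that is encoded by a labelled tree: the root is the
strongest inner vertex of the path, the left and right subtrees encode the two parts into which it
splits the path. A root outside `S a b` makes the weight vanish. -/
noncomputable def innerWeight : (T : BinaryTree Unit) → α → α → (TreeNode T → α) → ℝ≥0∞
  | .nil, a, b, _ => w a b
  | .node _ l r, a, b, x => (S a b).indicator
      (fun u => innerWeight l a u (leftLabels x) * innerWeight r u b (rightLabels x)) (rootLabel x)

/-- The weight of a path from `a` to its strongest vertex, encoded by a labelled tree: the right
spine consists of the vertices that are stronger than all their predecessors. A vertex of the spine
that is outside `U` of the previous one makes the weight vanish, and the last vertex has the extra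
weight `h`. -/
noncomputable def outerWeight : (T : BinaryTree Unit) → α → (TreeNode T → α) → ℝ≥0∞
  | .nil, a, _ => h a
  | .node _ l r, a, x => (U a).indicator
      (fun u => innerWeight w S l a u (leftLabels x) * outerWeight r u (rightLabels x))
      (rootLabel x)

variable {w S U h} [MeasurableSpace α]

theorem measurable_innerWeight (hw : Measurable w.uncurry)
    (hS : MeasurableSet {p : α × α × α | p.2.2 ∈ S p.1 p.2.1}) {Ω : Type*} [MeasurableSpace Ω]
    (T : BinaryTree Unit) {f g : Ω → α} {x : Ω → TreeNode T → α} (hf : Measurable f)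
    (hg : Measurable g) (hx : Measurable x) :
    Measurable fun ω => innerWeight w S T (f ω) (g ω) (x ω) := by
  induction T generalizing f g with
  | nil => exact hw.comp (hf.prodMk hg)
  | node _ l r ihl ihr =>
    have hu : Measurable fun ω => rootLabel (x ω) := measurable_rootLabel.comp hx
    exact ((ihl hf hu (measurable_leftLabels.comp hx)).mul
      (ihr hu hg (measurable_rightLabels.comp hx))).indicator (hf.prodMk (hg.prodMk hu) hS)

theorem measurable_outerWeight (hw : Measurable w.uncurry)
    (hS : MeasurableSet {p : α × α × α | p.2.2 ∈ S p.1 p.2.1})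
    (hU : MeasurableSet {p : α × α | p.2 ∈ U p.1}) (hh : Measurable h) {Ω : Type*}
    [MeasurableSpace Ω] (T : BinaryTree Unit) {f : Ω → α} {x : Ω → TreeNode T → α}
    (hf : Measurable f) (hx : Measurable x) :
    Measurable fun ω => outerWeight w S U h T (f ω) (x ω) := by
  induction T generalizing f with
  | nil => exact hh.comp hf
  | node _ l r _ ihr =>
    have hu : Measurable fun ω => rootLabel (x ω) := measurable_rootLabel.comp hx
    exact ((measurable_innerWeight hw hS l hf hu (measurable_leftLabels.comp hx)).mul
      (ihr hu (measurable_rightLabels.comp hx))).indicator (hf.prodMk hu hU)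

variable {μ : Measure α} [SigmaFinite μ] {K : ℝ≥0∞}

theorem lintegral_innerWeight_le (hw : Measurable w.uncurry)
    (hS : MeasurableSet {p : α × α × α | p.2.2 ∈ S p.1 p.2.1})
    (hK : ∀ a b, ∫⁻ u in S a b, w a u * w u b ∂μ ≤ K * w a b) (T : BinaryTree Unit) (a b : α) :
    ∫⁻ x, innerWeight w S T a b x ∂(Measure.pi fun _ => μ) ≤ K ^ T.numNodes * w a b := by
  induction T generalizing a b with
  | nil => simp [innerWeight, BinaryTree.numNodes]
  | node _ l r ihl ihr =>
    have hSab : MeasurableSet (S a b) :=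
      (measurable_const.prodMk (measurable_const.prodMk measurable_id)) hS
    have hwab : Measurable fun u => w a u * w u b :=
      (hw.comp measurable_prodMk_left).mul (hw.comp measurable_prodMk_right)
    calc ∫⁻ x, innerWeight w S (.node () l r) a b x ∂(Measure.pi fun _ => μ)
        = ∫⁻ u in S a b, (∫⁻ y, innerWeight w S l a u y ∂(Measure.pi fun _ => μ))
            * ∫⁻ z, innerWeight w S r u b z ∂(Measure.pi fun _ => μ) ∂μ :=
          lintegral_indicator_rootLabel μ hSab
            (measurable_innerWeight hw hS l measurable_const measurable_fst measurable_snd)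
            (measurable_innerWeight hw hS r measurable_fst measurable_const measurable_snd)
      _ ≤ ∫⁻ u in S a b, K ^ (l.numNodes + r.numNodes) * (w a u * w u b) ∂μ := by
          refine lintegral_mono fun u => (mul_le_mul' (ihl a u) (ihr u b)).trans_eq ?_
          ring
      _ = K ^ (l.numNodes + r.numNodes) * ∫⁻ u in S a b, w a u * w u b ∂μ :=
          lintegral_const_mul _ hwab
      _ ≤ K ^ (l.numNodes + r.numNodes) * (K * w a b) := mul_le_mul' le_rfl (hK a b)
      _ = K ^ (BinaryTree.node () l r).numNodes * w a b := by rw [BinaryTree.numNodes]; ring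

theorem lintegral_outerWeight_le (hw : Measurable w.uncurry)
    (hS : MeasurableSet {p : α × α × α | p.2.2 ∈ S p.1 p.2.1})
    (hU : MeasurableSet {p : α × α | p.2 ∈ U p.1}) (hh : Measurable h)
    (hK : ∀ a b, ∫⁻ u in S a b, w a u * w u b ∂μ ≤ K * w a b)
    (hKh : ∀ a, ∫⁻ u in U a, w a u * h u ∂μ ≤ K * h a) (T : BinaryTree Unit) (a : α) :
    ∫⁻ x, outerWeight w S U h T a x ∂(Measure.pi fun _ => μ) ≤ K ^ T.numNodes * h a := by
  induction T generalizing a with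
  | nil => simp [outerWeight, BinaryTree.numNodes]
  | node _ l r _ ihr =>
    have hwh : Measurable fun u => w a u * h u := (hw.comp measurable_prodMk_left).mul hh
    calc ∫⁻ x, outerWeight w S U h (.node () l r) a x ∂(Measure.pi fun _ => μ)
        = ∫⁻ u in U a, (∫⁻ y, innerWeight w S l a u y ∂(Measure.pi fun _ => μ))
            * ∫⁻ z, outerWeight w S U h r u z ∂(Measure.pi fun _ => μ) ∂μ :=
          lintegral_indicator_rootLabel μ (measurable_prodMk_left hU)
            (measurable_innerWeight hw hS l measurable_const measurable_fst measurable_snd)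
            (measurable_outerWeight hw hS hU hh r measurable_fst measurable_snd)
      _ ≤ ∫⁻ u in U a, K ^ (l.numNodes + r.numNodes) * (w a u * h u) ∂μ := by
          refine lintegral_mono fun u =>
            (mul_le_mul' (lintegral_innerWeight_le hw hS hK l a u) (ihr u)).trans_eq ?_
          ring
      _ = K ^ (l.numNodes + r.numNodes) * ∫⁻ u in U a, w a u * h u ∂μ :=
          lintegral_const_mul _ hwh
      _ ≤ K ^ (l.numNodes + r.numNodes) * (K * h a) := mul_le_mul' le_rfl (hKh a)
      _ = K ^ (BinaryTree.node () l r).numNodes * h a := by rw [BinaryTree.numNodes]; ring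

end TreeWeights

section Paths

variable {α : Type*}

/-- The steps of the path that starts in `a` and then visits the entries of `L`. -/
def pathSteps (a : α) (L : List α) : List (α × α) := (a :: L).zip L

/-- The product of the weights of the steps of the path that starts in `a` and then visits the
entries of `L`. -/
noncomputable def pathWeight (w : α → α → ℝ≥0∞) (a : α) (L : List α) : ℝ≥0∞ :=
  ((pathSteps a L).map fun e => w e.1 e.2).prod

theorem pathWeight_nil (w : α → α → ℝ≥0∞) (a : α) : pathWeight w a [] = 1 := rfl

theorem pathWeight_cons (w : α → α → ℝ≥0∞) (a b : α) (L : List α) :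
    pathWeight w a (b :: L) = w a b * pathWeight w b L := rfl

theorem pathWeight_append_cons (w : α → α → ℝ≥0∞) (a u : α) (l₁ l₂ : List α) :
    pathWeight w a (l₁ ++ u :: l₂) = pathWeight w a (l₁ ++ [u]) * pathWeight w u l₂ := by
  induction l₁ generalizing a with
  | nil => simp [pathWeight_cons, pathWeight_nil]
  | cons b l ih => simp [pathWeight_cons, ih, mul_assoc]

theorem nodup_pathSteps (a : α) {L : List α} (hL : L.Nodup) : (pathSteps a L).Nodup := by
  refine List.Nodup.of_map Prod.snd ?_
  rwa [pathSteps, List.map_snd_zip (by simp)]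

theorem exists_getElem_of_mem_pathSteps {a : α} {L : List α} {e : α × α} (he : e ∈ pathSteps a L) :
    ∃ (i : ℕ) (h : i + 1 < (a :: L).length), e = ((a :: L)[i], (a :: L)[i + 1]) := by
  obtain ⟨i, hi, rfl⟩ := List.mem_iff_getElem.1 he
  have hi' : i < L.length := by simpa [pathSteps] using hi
  exact ⟨i, by simpa using hi', by simp [pathSteps]⟩

theorem swap_notMem_pathSteps {a : α} {L : List α} (hL : (a :: L).Nodup) {e : α × α}
    (he : e ∈ pathSteps a L) : e.swap ∉ pathSteps a L := by
  intro he'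
  obtain ⟨i, hi, rfl⟩ := exists_getElem_of_mem_pathSteps he
  obtain ⟨j, hj, hij⟩ := exists_getElem_of_mem_pathSteps he'
  obtain ⟨hfst, hsnd⟩ := Prod.ext_iff.1 hij
  have : i + 1 = j := hL.getElem_inj_iff.1 hfst
  have : i = j + 1 := hL.getElem_inj_iff.1 hsnd
  omega

theorem injOn_fst_pathSteps {a : α} {L : List α} (hL : (a :: L).Nodup) :
    Set.InjOn Prod.fst {e | e ∈ pathSteps a L} := by
  intro e he f hf hef
  obtain ⟨i, hi, rfl⟩ := exists_getElem_of_mem_pathSteps he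
  obtain ⟨j, hj, rfl⟩ := exists_getElem_of_mem_pathSteps hf
  obtain rfl : i = j := hL.getElem_inj_iff.1 hef
  rfl

theorem injOn_snd_pathSteps {a : α} {L : List α} (hL : (a :: L).Nodup) :
    Set.InjOn Prod.snd {e | e ∈ pathSteps a L} := by
  intro e he f hf hef
  obtain ⟨i, hi, rfl⟩ := exists_getElem_of_mem_pathSteps he
  obtain ⟨j, hj, rfl⟩ := exists_getElem_of_mem_pathSteps hf
  obtain rfl : i = j := Nat.succ_injective (hL.getElem_inj_iff.1 hef)
  rfl

theorem forall_mem_pathSteps_of_isChain {R : α → α → Prop} {a : α} {L : List α}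
    (h : (a :: L).IsChain R) : ∀ e ∈ pathSteps a L, R e.1 e.2 := by
  intro e he
  obtain ⟨i, hi, rfl⟩ := exists_getElem_of_mem_pathSteps he
  exact List.isChain_iff_getElem.1 h i hi

/-- No two non-consecutive entries of `L` are related by `R`. -/
def NoShortcut (R : α → α → Prop) (L : List α) : Prop :=
  ∀ a b l, a :: l ++ [b] <:+: L → l ≠ [] → ¬R a b

theorem NoShortcut.infix {R : α → α → Prop} {L L' : List α} (h : NoShortcut R L)
    (hL : L' <:+: L) : NoShortcut R L' :=
  fun a b l hl => h a b l (hl.trans hL)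

theorem NoShortcut.reverse {R : α → α → Prop} (hR : ∀ a b, R a b → R b a) {L : List α}
    (h : NoShortcut R L) : NoShortcut R L.reverse := by
  intro a b l hl hne hab
  refine h b a l.reverse ?_ (by simpa using hne) (hR a b hab)
  simpa using List.reverse_infix.2 hl

end Paths

section PathsAndTrees

variable {α ι : Type*} [LinearOrder ι] (m : α → ι)

/-- The points with larger mark than both `a` and `b` that may connect them along a path without
shortcuts: there are none if `a` and `b` are related by `R`. -/
def connectors (R : α → α → Prop) (a b : α) : Set α :=
  {u | (m a ≤ m u ∧ m b ≤ m u) ∧ ¬R a b}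

/-- The points that are at least as strong as `a`, where a smaller mark means a stronger point. -/
def stronger (a : α) : Set α := {u | m u ≤ m a}

theorem exists_eq_append_cons_le {L : List α} (hL : L ≠ []) :
    ∃ l₁ u l₂, L = l₁ ++ u :: l₂ ∧ ∀ v ∈ L, m u ≤ m v := by
  obtain ⟨u, hu, hmin⟩ := Set.exists_min_image {v | v ∈ L} m L.finite_toSet
    (List.exists_mem_of_ne_nil L hL)
  obtain ⟨l₁, l₂, rfl⟩ := List.append_of_mem hu
  exact ⟨l₁, u, l₂, rfl, hmin⟩

theorem exists_eq_append_cons_first {p : α → Prop} {L : List α} (hL : ∃ v ∈ L, p v) :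
    ∃ l₁ u l₂, L = l₁ ++ u :: l₂ ∧ p u ∧ ∀ v ∈ l₁, ¬p v := by
  classical
  have hsome : (L.find? fun v => decide (p v)).isSome := by simpa using hL
  obtain ⟨u, hu⟩ := Option.isSome_iff_exists.1 hsome
  obtain ⟨hpu, l₁, l₂, rfl, hl₁⟩ := List.find?_eq_some_iff_append.1 hu
  exact ⟨l₁, u, l₂, rfl, by simpa using hpu, by simpa using hl₁⟩

variable {m} (w : α → α → ℝ≥0∞) {R : α → α → Prop}

theorem exists_innerWeight_eq (a b : α) (L : List α) (hL : NoShortcut R (a :: L ++ [b]))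
    (hm : ∀ v ∈ L, m a ≤ m v ∧ m b ≤ m v) :
    ∃ (T : BinaryTree Unit) (x : TreeNode T → α), inorderLabels T x = L ∧
      innerWeight w (connectors m R) T a b x = pathWeight w a (L ++ [b]) := by
  induction hn : L.length using Nat.strong_induction_on generalizing a b L with
  | _ n ih =>
  rcases eq_or_ne L [] with rfl | hne
  · exact ⟨.nil, isEmptyElim, rfl, (mul_one _).symm⟩
  have hab : ¬R a b := hL a b L List.infix_rfl hne
  obtain ⟨l₁, u, l₂, rfl, hmin⟩ := exists_eq_append_cons_le m hne
  rw [List.length_append, List.length_cons] at hn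
  obtain ⟨T₁, x₁, hx₁, hw₁⟩ := ih l₁.length (by omega) a u l₁
    (hL.infix ⟨[], l₂ ++ [b], by simp⟩)
    (fun v hv => ⟨(hm v (by simp [hv])).1, hmin v (by simp [hv])⟩) rfl
  obtain ⟨T₂, x₂, hx₂, hw₂⟩ := ih l₂.length (by omega) u b l₂
    (hL.infix ⟨a :: l₁, [], by simp⟩)
    (fun v hv => ⟨hmin v (by simp [hv]), (hm v (by simp [hv])).2⟩) rfl
  refine ⟨.node () T₁ T₂, nodeLabels u x₁ x₂, by rw [inorderLabels_nodeLabels, hx₁, hx₂], ?_⟩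
  have hu : u ∈ connectors m R a b := ⟨hm u (by simp), hab⟩
  calc innerWeight w (connectors m R) (.node () T₁ T₂) a b (nodeLabels u x₁ x₂)
      = innerWeight w (connectors m R) T₁ a u x₁ * innerWeight w (connectors m R) T₂ u b x₂ :=
        Set.indicator_of_mem hu _
    _ = pathWeight w a ((l₁ ++ u :: l₂) ++ [b]) := by
        rw [hw₁, hw₂, List.append_assoc, List.cons_append, ← pathWeight_append_cons]

theorem exists_outerWeight_eq (h : α → ℝ≥0∞) (a : α) (L : List α) (hL : NoShortcut R (a :: L))
    (hm : ∀ v ∈ a :: L, m (L.getLastD a) ≤ m v) :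
    ∃ (T : BinaryTree Unit) (x : TreeNode T → α), inorderLabels T x = L ∧
      outerWeight w (connectors m R) (stronger m) h T a x
        = pathWeight w a L * h (L.getLastD a) := by
  induction hn : L.length using Nat.strong_induction_on generalizing a L with
  | _ n ih =>
  rcases L.eq_nil_or_concat with rfl | ⟨L', z, hLz⟩
  · exact ⟨.nil, isEmptyElim, rfl, (one_mul _).symm⟩
  have hlast : ∃ v ∈ L, m v ≤ m a :=
    ⟨L.getLastD a, by simp [hLz], hm a List.mem_cons_self⟩
  obtain ⟨l₁, u, l₂, rfl, hua, hl₁⟩ := exists_eq_append_cons_first hlast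
  have hl₁ : ∀ v ∈ l₁, m a ≤ m v := fun v hv => (not_le.1 (hl₁ v hv)).le
  have hgetLast : (l₁ ++ u :: l₂).getLastD a = l₂.getLastD u := by
    simp [List.getLast?_cons]
  rw [hgetLast] at hm ⊢
  rw [List.length_append, List.length_cons] at hn
  obtain ⟨T₁, x₁, hx₁, hw₁⟩ := exists_innerWeight_eq w a u l₁
    (hL.infix ⟨[], l₂, by simp⟩) (fun v hv => ⟨hl₁ v hv, hua.trans (hl₁ v hv)⟩)
  obtain ⟨T₂, x₂, hx₂, hw₂⟩ := ih l₂.length (by omega) u l₂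
    (hL.infix ⟨a :: l₁, [], by simp⟩)
    (fun v hv => hm v (by simp only [List.mem_cons, List.mem_append] at hv ⊢; tauto)) rfl
  refine ⟨.node () T₁ T₂, nodeLabels u x₁ x₂, by rw [inorderLabels_nodeLabels, hx₁, hx₂], ?_⟩
  have hu : u ∈ stronger m a := hua
  calc outerWeight w (connectors m R) (stronger m) h (.node () T₁ T₂) a (nodeLabels u x₁ x₂)
      = innerWeight w (connectors m R) T₁ a u x₁
          * outerWeight w (connectors m R) (stronger m) h T₂ u x₂ := Set.indicator_of_mem hu _
    _ = pathWeight w a (l₁ ++ u :: l₂) * h (l₂.getLastD u) := by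
        rw [hw₁, hw₂, pathWeight_append_cons w a u l₁ l₂, mul_assoc]

end PathsAndTrees

section Geodesics

variable {V : Type*} {H : SimpleGraph V}

theorem noShortcut_support {u v : V} {p : H.Walk u v} (hp : p.length = H.dist u v) :
    NoShortcut H.Adj p.support := by
  intro a b l hl hne hab
  have hchain : (a :: l ++ [b]).IsChain H.Adj := p.isChain_adj_support.infix hl
  let q := SimpleGraph.Walk.ofSupport _ (List.append_ne_nil_of_left_ne_nil (by simp) _) hchain
  have hsupport : q.support = a :: l ++ [b] := SimpleGraph.Walk.support_ofSupport _ hchain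
  have hq : q.length = H.dist ((a :: l ++ [b]).head _) ((a :: l ++ [b]).getLast _) :=
    SimpleGraph.length_eq_dist_of_subwalk hp
      (SimpleGraph.Walk.isSubwalk_iff_support_isInfix.2 (hsupport.symm ▸ hl))
  have hdist : q.length = 1 := by
    simpa [SimpleGraph.dist_eq_one_iff_adj.2 hab] using hq
  have hlength : q.support.length = l.length + 2 := by
    rw [hsupport]; simp
  rw [q.length_support] at hlength
  exact hne (List.length_eq_zero_iff.1 (by omega))

theorem exists_support_eq_cons_append {x y : V} (hxy : x ≠ y) (p : H.Walk x y) :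
    ∃ l, p.support = x :: l ++ [y] := by
  induction p using SimpleGraph.Walk.concatRec with
  | Hnil => exact absurd rfl hxy
  | Hconcat p h _ =>
    refine ⟨p.support.tail, ?_⟩
    rw [SimpleGraph.Walk.support_concat, SimpleGraph.Walk.cons_tail_support]

theorem exists_geodesic {x y : V} (hxy : x ≠ y) {N : ℕ} (hN : H.edist x y ≤ N) :
    ∃ l, l.length + 1 ≤ N ∧ (x :: l ++ [y]).Nodup ∧ (x :: l ++ [y]).IsChain H.Adj ∧
      NoShortcut H.Adj (x :: l ++ [y]) := by
  obtain ⟨p, hp⟩ := SimpleGraph.exists_walk_of_edist_ne_top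
    (ne_top_of_le_ne_top (ENat.natCast_ne_top N) hN)
  have hdist : p.length = H.dist x y := by rw [SimpleGraph.dist, ← hp, ENat.toNat_natCast]
  have hpN : p.length ≤ N := by exact_mod_cast hp.trans_le hN
  obtain ⟨l, hl⟩ := exists_support_eq_cons_append hxy p
  have hlength : p.length = l.length + 1 := by simpa [hl] using p.length_support.symm
  exact ⟨l, hlength ▸ hpN, hl ▸ (p.isPath_of_length_eq_dist hdist).support_nodup,
    hl ▸ p.isChain_adj_support, hl ▸ noShortcut_support hdist⟩

end Geodesics

section FarPaths

variable {d : ℕ} {κ δ γ : ℝ}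

/-- The graph `G` augmented by all pairs of vertices of `η` with edge factor at least `1`, for which
the assumed bound on the edge probabilities is void. -/
def augment (κ δ γ : ℝ) (η : Configuration d) (G : SimpleGraph (Vertex d)) :
    SimpleGraph (Vertex d) where
  Adj u v := u ≠ v ∧ (u ∈ η.carrier ∧ v ∈ η.carrier) ∧ (G.Adj u v ∨ 1 ≤ edgeFactor κ δ γ u v)
  symm := ⟨fun u v ⟨hne, hη, h⟩ =>
    ⟨hne.symm, hη.symm, h.imp SimpleGraph.Adj.symm fun h => edgeFactor_comm κ δ γ u v ▸ h⟩⟩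

theorem le_augment {η : Configuration d} {G : SimpleGraph (Vertex d)}
    (hG : ∀ u v, G.Adj u v → u ∈ η.carrier ∧ v ∈ η.carrier) : G ≤ augment κ δ γ η G :=
  fun _ _ h => ⟨h.ne, hG _ _ h, Or.inl h⟩

/-- `L` lists the vertices after `x` of a path without shortcuts through at most `N` points of `η`
that ends in the strongest of these points, at distance at least `ρ` from `x`. -/
structure IsFarPath (κ δ γ : ℝ) (η : Configuration d) (x : Vertex d) (N : ℕ) (ρ : ℝ)
    (L : List (Vertex d)) : Prop where
  length_le : L.length ≤ N
  nodup : (x :: L).Nodup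
  mem_carrier : ∀ v ∈ L, v ∈ η.carrier
  noShortcut : NoShortcut (fun u v => 1 ≤ edgeFactor κ δ γ u v) (x :: L)
  last_le : ∀ v ∈ L, (L.getLastD x).2 ≤ v.2
  le_norm_sub_last : ρ ≤ ‖x.1 - (L.getLastD x).1‖

theorem countable_isFarPath (κ δ γ : ℝ) (η : Configuration d) (x : Vertex d) (N : ℕ) (ρ : ℝ) :
    Countable {L // IsFarPath κ δ γ η x N ρ L} := by
  have : Countable η.carrier := η.countable_carrier.to_subtype
  refine ((Set.countable_range fun L : List η.carrier => L.map Subtype.val).mono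
    fun L hL => ?_).to_subtype
  have hη := IsFarPath.mem_carrier hL
  lift L to List η.carrier using hη
  exact ⟨L, rfl⟩

theorem isFarPath_of_infix {η : Configuration d} {x z : Vertex d} {N : ℕ} {ρ : ℝ}
    {l L : List (Vertex d)} (hL : x :: l ++ [z] <:+: L) (hN : l.length + 1 ≤ N) (hnd : L.Nodup)
    (hη : ∀ v ∈ l ++ [z], v ∈ η.carrier)
    (hshort : NoShortcut (fun u v => 1 ≤ edgeFactor κ δ γ u v) L) (hz : ∀ v ∈ l ++ [z], z.2 ≤ v.2)
    (hρ : ρ ≤ ‖x.1 - z.1‖) : IsFarPath κ δ γ η x N ρ (l ++ [z]) where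
  length_le := by simpa using hN
  nodup := hnd.sublist hL.sublist
  mem_carrier := hη
  noShortcut := hshort.infix hL
  last_le := by simpa using hz
  le_norm_sub_last := by simpa using hρ

theorem mem_carrier_of_isChain_augment {η : Configuration d} {G : SimpleGraph (Vertex d)}
    {L : List (Vertex d)} (hL : L.IsChain (augment κ δ γ η G).Adj) (hlen : 2 ≤ L.length) :
    ∀ v ∈ L, v ∈ η.carrier := by
  intro v hv
  obtain ⟨i, hi, rfl⟩ := List.mem_iff_getElem.1 hv
  rw [List.isChain_iff_getElem] at hL
  rcases Nat.lt_or_ge (i + 1) L.length with hi' | hi'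
  · exact (hL i hi').2.1.1
  · obtain ⟨j, rfl⟩ : ∃ j, i = j + 1 := ⟨i - 1, by omega⟩
    exact (hL j hi).2.1.2

theorem NoShortcut.of_augment {η : Configuration d} {G : SimpleGraph (Vertex d)}
    {L : List (Vertex d)} (h : NoShortcut (augment κ δ γ η G).Adj L) (hnd : L.Nodup)
    (hη : ∀ v ∈ L, v ∈ η.carrier) : NoShortcut (fun u v => 1 ≤ edgeFactor κ δ γ u v) L := by
  intro a b l hl hne hab
  have hne_ab : a ≠ b := by
    rintro rfl
    simpa using hnd.sublist hl.sublist
  exact h a b l hl hne ⟨hne_ab, ⟨hη a (hl.subset (by simp)), hη b (hl.subset (by simp))⟩,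
    Or.inr hab⟩

theorem mem_carrier_of_mem_addPoint {η : Configuration d} {x y : Vertex d} {l : List (Vertex d)}
    (hnd : (x :: l ++ [y]).Nodup)
    (hη : ∀ v ∈ x :: l ++ [y], v ∈ ((η.addPoint x).addPoint y).carrier) :
    ∀ v ∈ l, v ∈ η.carrier := by
  intro v hv
  have hvx : v ≠ x := by rintro rfl; simp [hv] at hnd
  have hvy : v ≠ y := by rintro rfl; simp [List.nodup_append', hv] at hnd
  exact ((hη v (by simp [hv])).resolve_left hvy).resolve_left hvx

theorem exists_isFarPath {G : SimpleGraph (Vertex d)} {η : Configuration d} {x y : Vertex d}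
    (hxy : x ≠ y) {N : ℕ}
    (hN : (augment κ δ γ ((η.addPoint x).addPoint y) G).edist x y ≤ N) :
    (augment κ δ γ ((η.addPoint x).addPoint y) G).Adj x y ∨
      (∃ L, IsFarPath κ δ γ η x N (‖x.1 - y.1‖ / 2) L ∧
        (x :: L).IsChain (augment κ δ γ ((η.addPoint x).addPoint y) G).Adj) ∨
      ∃ L, IsFarPath κ δ γ η y N (‖x.1 - y.1‖ / 2) L ∧
        (y :: L).IsChain (augment κ δ γ ((η.addPoint x).addPoint y) G).Adj := by
  obtain ⟨l, hlen, hnd, hchain, hshort⟩ := exists_geodesic hxy hN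
  rcases eq_or_ne l [] with rfl | hne
  · exact Or.inl (by simpa using hchain)
  have hη' := mem_carrier_of_isChain_augment hchain (by simp)
  have hshort := hshort.of_augment hnd hη'
  have hη := mem_carrier_of_mem_addPoint hnd hη'
  obtain ⟨l₁, z, l₂, rfl, hz⟩ := exists_eq_append_cons_le (fun v : Vertex d => v.2) hne
  rw [List.length_append, List.length_cons] at hlen
  have htri : ‖x.1 - y.1‖ ≤ ‖x.1 - z.1‖ + ‖y.1 - z.1‖ := by
    rw [norm_sub_rev y.1]
    exact norm_sub_le_norm_sub_add_norm_sub _ _ _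
  right
  rcases le_total ‖y.1 - z.1‖ ‖x.1 - z.1‖ with hxz | hyz
  · have hprefix : x :: l₁ ++ [z] <:+: x :: (l₁ ++ z :: l₂) ++ [y] := ⟨[], l₂ ++ [y], by simp⟩
    have hsub : ∀ v ∈ l₁ ++ [z], v ∈ l₁ ++ z :: l₂ := fun v => by simp; tauto
    exact Or.inl ⟨l₁ ++ [z], isFarPath_of_infix hprefix (by omega) hnd
      (fun v hv => hη v (hsub v hv)) hshort (fun v hv => hz v (hsub v hv)) (by linarith),
      hchain.infix hprefix⟩
  · have hsuffix : y :: l₂.reverse ++ [z] <:+: (x :: (l₁ ++ z :: l₂) ++ [y]).reverse :=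
      ⟨[], l₁.reverse ++ [x], by simp⟩
    have hsub : ∀ v ∈ l₂.reverse ++ [z], v ∈ l₁ ++ z :: l₂ := fun v => by simp; tauto
    have hsymm : ∀ u v : Vertex d, 1 ≤ edgeFactor κ δ γ u v → 1 ≤ edgeFactor κ δ γ v u :=
      fun u v h => edgeFactor_comm κ δ γ u v ▸ h
    exact Or.inr ⟨l₂.reverse ++ [z], isFarPath_of_infix hsuffix (by simp; omega)
      (List.nodup_reverse.2 hnd) (fun v hv => hη v (hsub v hv)) (hshort.reverse hsymm)
      (fun v hv => hz v (hsub v hv)) (by linarith),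
      (List.isChain_reverse.2 (hchain.imp fun _ _ h => h.symm)).infix hsuffix⟩

end FarPaths

section LawBounds

variable {d : ℕ} {𝒢 : GeometricRandomGraph d} {κ δ γ : ℝ} {η : Configuration d}

open Classical in
theorem GeometricRandomGraph.EdgeBoundAt.law_isChain_augment_le (h : 𝒢.EdgeBoundAt κ δ γ η)
    {a : Vertex d} {L : List (Vertex d)} (hη : ∀ v ∈ a :: L, v ∈ η.carrier)
    (hnd : (a :: L).Nodup) :
    𝒢.law η {G | (a :: L).IsChain (augment κ δ γ η G).Adj}
      ≤ pathWeight (edgeWeight κ δ γ) a L := by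
  let I : Finset (Vertex d × Vertex d) :=
    (pathSteps a L).toFinset.filter fun e => edgeFactor κ δ γ e.1 e.2 < 1
  have hI : ∀ e ∈ I, e ∈ pathSteps a L := fun e he => by simpa using (Finset.mem_filter.1 he).1
  have hprod : ∏ e ∈ I, edgeFactor κ δ γ e.1 e.2 = pathWeight (edgeWeight κ δ γ) a L := by
    rw [pathWeight, ← List.prod_toFinset _ (nodup_pathSteps a (List.nodup_cons.1 hnd).2),
      Finset.prod_filter]
    refine Finset.prod_congr rfl fun e _ => ?_
    split_ifs with he
    · exact (min_eq_right he.le).symm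
    · exact (min_eq_left (not_lt.1 he)).symm
  have hcard : ∀ π : Vertex d × Vertex d → Vertex d, Set.InjOn π {e | e ∈ pathSteps a L} →
      ∀ v, (I.filter fun e => π e = v).card ≤ 1 := by
    refine fun π hπ v => Finset.card_le_one.2 fun e he f hf => ?_
    rw [Finset.mem_filter] at he hf
    exact hπ (hI e he.1) (hI f hf.1) (he.2.trans hf.2.symm)
  rw [← hprod]
  refine (measure_mono fun G hG e he => ?_).trans (h I (fun e he => ?_) (fun e he he' => ?_) ?_)
  · exact (forall_mem_pathSteps_of_isChain hG e (hI e he)).2.2.resolve_right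
      (Finset.mem_filter.1 he).2.not_ge
  · obtain ⟨i, hi, rfl⟩ := exists_getElem_of_mem_pathSteps (hI e he)
    exact ⟨hη _ (List.getElem_mem _), hη _ (List.getElem_mem _)⟩
  · exact swap_notMem_pathSteps hnd (hI e he) (hI _ he')
  · exact fun v => add_le_add (hcard _ (injOn_fst_pathSteps hnd) v)
      (hcard _ (injOn_snd_pathSteps hnd) v)

theorem GeometricRandomGraph.EdgeBoundAt.law_edist_le {x y : Vertex d} (hxy : x ≠ y)
    (h : 𝒢.EdgeBoundAt κ δ γ ((η.addPoint x).addPoint y)) (N : ℕ) :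
    𝒢.law ((η.addPoint x).addPoint y) {G | G.edist x y ≤ N}
      ≤ edgeFactor κ δ γ x y
        + (∑' L : {L // IsFarPath κ δ γ η x N (‖x.1 - y.1‖ / 2) L},
            pathWeight (edgeWeight κ δ γ) x L
          + ∑' L : {L // IsFarPath κ δ γ η y N (‖x.1 - y.1‖ / 2) L},
            pathWeight (edgeWeight κ δ γ) y L) := by
  set η' := (η.addPoint x).addPoint y
  set ρ := ‖x.1 - y.1‖ / 2
  have hx : x ∈ η'.carrier := Or.inr (Or.inl rfl)
  have hy : y ∈ η'.carrier := Or.inl rfl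
  have hsub : η.carrier ⊆ η'.carrier := fun v hv => Or.inr (Or.inr hv)
  have hfar : ∀ v ∈ η'.carrier,
      𝒢.law η' (⋃ L : {L // IsFarPath κ δ γ η v N ρ L},
        {G | (v :: L.1).IsChain (augment κ δ γ η' G).Adj})
      ≤ ∑' L : {L // IsFarPath κ δ γ η v N ρ L}, pathWeight (edgeWeight κ δ γ) v L := by
    intro v hv
    have := countable_isFarPath κ δ γ η v N ρ
    refine (measure_iUnion_le _).trans (ENNReal.tsum_le_tsum fun L => ?_)
    exact h.law_isChain_augment_le
      (List.forall_mem_cons.2 ⟨hv, fun u hu => hsub (L.2.mem_carrier u hu)⟩) L.2.nodup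
  have hdirect : 𝒢.law η' {G | (augment κ δ γ η' G).Adj x y} ≤ edgeFactor κ δ γ x y := by
    have hstep := h.law_isChain_augment_le (a := x) (L := [y]) (by simp [hx, hy])
      (by simpa using hxy)
    refine (measure_mono fun G hG => ?_).trans (hstep.trans ?_)
    · simpa using hG
    · simp [pathWeight_cons, pathWeight_nil, edgeWeight]
  refine le_trans (measure_mono_ae ?_) ((measure_union_le _ _).trans (add_le_add hdirect
    ((measure_union_le _ _).trans (add_le_add (hfar x hx) (hfar y hy)))))
  filter_upwards [𝒢.mem_of_adj η'] with G hG hd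
  have hN : (augment κ δ γ η' G).edist x y ≤ N :=
    (SimpleGraph.edist_anti (le_augment hG)).trans hd
  rcases exists_isFarPath hxy hN with hadj | ⟨L, hL, hchain⟩ | ⟨L, hL, hchain⟩
  · exact Or.inl hadj
  · exact Or.inr (Or.inl (Set.mem_iUnion.2 ⟨⟨L, hL⟩, hchain⟩))
  · exact Or.inr (Or.inr (Set.mem_iUnion.2 ⟨⟨L, hL⟩, hchain⟩))

end LawBounds

section Trees

/-- The binary trees with at most `N` nodes. -/
def treesUpTo (N : ℕ) : Finset (BinaryTree Unit) :=
  (Finset.range (N + 1)).biUnion BinaryTree.treesOfNumNodesEq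

theorem mem_treesUpTo {N : ℕ} {T : BinaryTree Unit} : T ∈ treesUpTo N ↔ T.numNodes ≤ N := by
  simp [treesUpTo, BinaryTree.mem_treesOfNumNodesEq]

theorem catalan_le_four_pow (n : ℕ) : catalan n ≤ 4 ^ n := by
  rw [catalan_eq_centralBinom_div, Nat.centralBinom_eq_two_mul_choose]
  calc (2 * n).choose n / (n + 1) ≤ (2 * n).choose n := Nat.div_le_self _ _
    _ ≤ 2 ^ (2 * n) := Nat.choose_le_two_pow _ _
    _ = 4 ^ n := by rw [pow_mul]; norm_num

theorem sum_treesOfNumNodesEq_le (K : ℝ≥0∞) (n : ℕ) :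
    ∑ T ∈ BinaryTree.treesOfNumNodesEq n, K ^ T.numNodes ≤ (4 * K) ^ n :=
  calc ∑ T ∈ BinaryTree.treesOfNumNodesEq n, K ^ T.numNodes
      = ∑ _ ∈ BinaryTree.treesOfNumNodesEq n, K ^ n :=
        Finset.sum_congr rfl fun T hT => by rw [BinaryTree.mem_treesOfNumNodesEq.1 hT]
    _ = catalan n * K ^ n := by
        rw [Finset.sum_const, BinaryTree.treesOfNumNodesEq_card_eq_catalan, nsmul_eq_mul]
    _ ≤ 4 ^ n * K ^ n := by
        gcongr
        exact_mod_cast catalan_le_four_pow n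
    _ = (4 * K) ^ n := (mul_pow _ _ _).symm

theorem sum_treesUpTo_le (K : ℝ≥0∞) (N : ℕ) :
    ∑ T ∈ treesUpTo N, K ^ T.numNodes ≤ (2 * (1 + 4 * K)) ^ N := by
  have hdisj : Set.PairwiseDisjoint (Finset.range (N + 1) : Set ℕ)
      BinaryTree.treesOfNumNodesEq := fun i _ j _ hij => Finset.disjoint_left.2 fun T hi hj =>
    hij ((BinaryTree.mem_treesOfNumNodesEq.1 hi).symm.trans (BinaryTree.mem_treesOfNumNodesEq.1 hj))
  calc ∑ T ∈ treesUpTo N, K ^ T.numNodes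
      = ∑ n ∈ Finset.range (N + 1), ∑ T ∈ BinaryTree.treesOfNumNodesEq n, K ^ T.numNodes :=
        Finset.sum_biUnion hdisj
    _ ≤ ∑ n ∈ Finset.range (N + 1), (1 + 4 * K) ^ N := by
        refine Finset.sum_le_sum fun n hn => (sum_treesOfNumNodesEq_le K n).trans ?_
        calc (4 * K) ^ n ≤ (1 + 4 * K) ^ n := pow_le_pow_left' le_add_self n
          _ ≤ (1 + 4 * K) ^ N :=
            pow_le_pow_right₀ le_self_add (Nat.lt_succ_iff.1 (Finset.mem_range.1 hn))
    _ = (N + 1 : ℕ) * (1 + 4 * K) ^ N := by simp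
    _ ≤ 2 ^ N * (1 + 4 * K) ^ N := by
        gcongr
        exact_mod_cast Nat.lt_two_pow_self
    _ = (2 * (1 + 4 * K)) ^ N := (mul_pow _ _ _).symm

end Trees

section Patterns

variable {d : ℕ} {κ δ γ b : ℝ}

/-- The weight of a path from `x` to the strongest of its other vertices. The first step leads to
the root of a labelled tree without left subtree, and the right subtree `T` encodes the path from
there on. -/
noncomputable def patternWeight (κ δ γ b : ℝ) (x : Vertex d) (T : BinaryTree Unit)
    (ω : TreeNode (.node () .nil T) → Vertex d) : ℝ≥0∞ :=
  edgeWeight κ δ γ x (rootLabel ω) *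
    outerWeight (edgeWeight κ δ γ)
      (connectors Prod.snd fun u v : Vertex d => 1 ≤ edgeFactor κ δ γ u v)
      (stronger Prod.snd) (reach b x.1) T (rootLabel ω) (rightLabels ω)

theorem measurableSet_connectors :
    MeasurableSet {p : Vertex d × Vertex d × Vertex d |
      p.2.2 ∈ connectors Prod.snd (fun u v => 1 ≤ edgeFactor κ δ γ u v) p.1 p.2.1} :=
  ((measurableSet_le (measurable_snd.comp measurable_fst)
    (measurable_snd.comp (measurable_snd.comp measurable_snd))).inter
      (measurableSet_le (measurable_snd.comp (measurable_fst.comp measurable_snd))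
        (measurable_snd.comp (measurable_snd.comp measurable_snd)))).inter
    (measurableSet_le measurable_const
      (measurable_edgeFactor measurable_fst (measurable_fst.comp measurable_snd))).compl

theorem measurableSet_stronger :
    MeasurableSet {p : Vertex d × Vertex d | p.2 ∈ stronger Prod.snd p.1} :=
  measurableSet_le (measurable_snd.comp measurable_snd) (measurable_snd.comp measurable_fst)

theorem measurable_edgeWeight_uncurry :
    Measurable (edgeWeight κ δ γ : Vertex d → Vertex d → ℝ≥0∞).uncurry := by
  unfold Function.uncurry
  fun_prop

theorem measurable_patternWeight (x : Vertex d) (T : BinaryTree Unit) :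
    Measurable (patternWeight κ δ γ b x T) :=
  (measurable_edgeWeight measurable_const measurable_rootLabel).mul
    (measurable_outerWeight measurable_edgeWeight_uncurry measurableSet_connectors
      measurableSet_stronger (measurable_reach measurable_id) T measurable_rootLabel
      measurable_rightLabels)

theorem setLIntegral_connectors_le {K : ℝ≥0∞} {x y : Vertex d}
    (hK : ∫⁻ u in Prod.snd ⁻¹' Set.Ici (max x.2 y.2), edgeWeight κ δ γ x u * edgeWeight κ δ γ u y
      ∂(vertexVolume d) ≤ K * edgeFactor κ δ γ x y) :
    ∫⁻ u in connectors Prod.snd (fun u v => 1 ≤ edgeFactor κ δ γ u v) x y,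
      edgeWeight κ δ γ x u * edgeWeight κ δ γ u y ∂(vertexVolume d)
      ≤ K * edgeWeight κ δ γ x y := by
  by_cases hxy : 1 ≤ edgeFactor κ δ γ x y
  · simp [connectors, hxy]
  · rw [edgeWeight, min_eq_right (not_le.1 hxy).le]
    refine (lintegral_mono_set fun u hu => ?_).trans hK
    exact max_le hu.1.1 hu.1.2

theorem lintegral_patternWeight_le {K : ℝ≥0∞} {x : Vertex d}
    (hK : ∀ a b : Vertex d, ∫⁻ u in Prod.snd ⁻¹' Set.Ici (max a.2 b.2),
      edgeWeight κ δ γ a u * edgeWeight κ δ γ u b ∂(vertexVolume d) ≤ K * edgeFactor κ δ γ a b)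
    (hKh : ∀ a : Vertex d, ∫⁻ u in Prod.snd ⁻¹' Set.Iic a.2,
      edgeWeight κ δ γ a u * reach b x.1 u ∂(vertexVolume d) ≤ K * reach b x.1 a)
    (T : BinaryTree Unit) :
    ∫⁻ ω, patternWeight κ δ γ b x T ω ∂(Measure.pi fun _ => vertexVolume d)
      ≤ (∫⁻ u, edgeWeight κ δ γ x u * reach b x.1 u ∂(vertexVolume d)) * K ^ T.numNodes := by
  have hw : Measurable (edgeWeight κ δ γ : Vertex d → Vertex d → ℝ≥0∞).uncurry :=
    measurable_edgeWeight_uncurry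
  have hh : Measurable (reach b x.1) := measurable_reach measurable_id
  let W := outerWeight (edgeWeight κ δ γ)
    (connectors Prod.snd fun u v : Vertex d => 1 ≤ edgeFactor κ δ γ u v)
    (stronger Prod.snd) (reach b x.1) T
  have hWle : ∀ u, ∫⁻ z, W u z ∂(Measure.pi fun _ => vertexVolume d)
      ≤ K ^ T.numNodes * reach b x.1 u :=
    lintegral_outerWeight_le hw measurableSet_connectors measurableSet_stronger hh
      (fun u v => setLIntegral_connectors_le (hK u v)) hKh T
  calc ∫⁻ ω, patternWeight κ δ γ b x T ω ∂(Measure.pi fun _ => vertexVolume d)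
      = ∫⁻ u, ∫⁻ _y, ∫⁻ z, edgeWeight κ δ γ x u * W u z ∂(Measure.pi fun _ => vertexVolume d)
          ∂(Measure.pi fun _ : TreeNode .nil => vertexVolume d) ∂(vertexVolume d) :=
        lintegral_nodeLabels _ (measurable_patternWeight x T)
    _ = ∫⁻ u, edgeWeight κ δ γ x u * ∫⁻ z, W u z ∂(Measure.pi fun _ => vertexVolume d)
          ∂(vertexVolume d) := by
        refine lintegral_congr fun u => ?_
        have hfinite : edgeWeight κ δ γ x u ≠ ∞ :=
          ne_top_of_le_ne_top ENNReal.one_ne_top (min_le_left _ _)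
        have hnil : (Measure.pi fun _ : TreeNode .nil => vertexVolume d) Set.univ = 1 := by
          rw [Measure.pi_of_empty, measure_univ]
        rw [lintegral_const, lintegral_const_mul' _ _ hfinite, hnil, mul_one]
    _ ≤ ∫⁻ u, edgeWeight κ δ γ x u * reach b x.1 u * K ^ T.numNodes ∂(vertexVolume d) := by
        refine lintegral_mono fun u => (mul_le_mul' le_rfl (hWle u)).trans_eq ?_
        ring
    _ = _ := lintegral_mul_const _ (by fun_prop)

theorem exists_lintegral_patternWeight_le (hd : 1 ≤ d) (hκ : 0 < κ) (hδ : 1 < δ) (hγ₀ : 0 ≤ γ)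
    (hγ : γ < δ / (δ + 1)) :
    ∃ b : ℝ, 0 < b ∧ ∃ K : ℝ≥0∞, K ≠ ∞ ∧ ∀ s, ∃ C : ℝ≥0∞, C ≠ ∞ ∧
      ∀ (x : EuclideanSpace ℝ (Fin d)) (T : BinaryTree Unit),
        ∫⁻ ω, patternWeight κ δ γ b (x, s) T ω ∂(Measure.pi fun _ => vertexVolume d)
          ≤ C * K ^ T.numNodes := by
  have hd' : (0 : ℝ) < d := by exact_mod_cast hd
  have hγ₁ : γ < 1 := hγ.trans ((div_lt_one (by linarith)).2 (by linarith))
  obtain ⟨b, hb, hbmin⟩ : ∃ b : ℝ, 0 < b ∧ b < min (1 / (d : ℝ)) (min (δ - 1) (1 - γ)) :=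
    exists_between (lt_min (by positivity) (lt_min (by linarith) (by linarith)))
  rw [lt_min_iff, lt_min_iff, lt_div_iff₀ hd', lt_sub_iff_add_lt', lt_sub_iff_add_lt'] at hbmin
  obtain ⟨hbd, hbδ, hbγ⟩ := hbmin
  obtain ⟨K₁, hK₁, hconn⟩ := exists_lintegral_connector_le hd hκ hδ hγ₀ hγ
  obtain ⟨K₂, hK₂, hreach⟩ := exists_lintegral_stronger_reach_le hd hκ hδ hb.le hbd.le hbδ hbγ
  refine ⟨b, hb, K₁ + K₂, by finiteness, fun s => ?_⟩
  obtain ⟨C, hC, hstart⟩ :=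
    exists_lintegral_edgeWeight_mul_reach_le hd hκ hδ hγ₀ hb hbd.le hbδ hbγ s
  refine ⟨C, hC, fun x T => (lintegral_patternWeight_le (K := K₁ + K₂) (fun u v => ?_)
    (fun u => ?_) T).trans (mul_le_mul' (hstart x) le_rfl)⟩
  · exact (hconn u v).trans (mul_le_mul' le_self_add le_rfl)
  · exact (hreach x u).trans (mul_le_mul' le_add_self le_rfl)

end Patterns

section FirstMoment

variable {d : ℕ} {κ δ γ b ρ : ℝ} {N : ℕ}

theorem IsFarPath.exists_pattern {η : Configuration d} {x : Vertex d} {L : List (Vertex d)}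
    (hL : IsFarPath κ δ γ η x N ρ L) (hb : 0 ≤ b) (hρ : 0 < ρ) :
    ∃ T ∈ treesUpTo N, ∃ ω ∈ η.labellings (TreeNode (.node () .nil T)),
      inorderLabels (.node () .nil T) ω = L ∧
      pathWeight (edgeWeight κ δ γ) x L * ENNReal.ofReal ρ ^ (b * d)
        ≤ patternWeight κ δ γ b x T ω := by
  have hfar := hL.le_norm_sub_last
  have hlast := hL.last_le
  cases L with
  | nil => simp only [List.getLastD_nil, sub_self, norm_zero] at hfar; linarith
  | cons u L =>
    rw [List.getLastD_cons] at hfar hlast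
    obtain ⟨T, z, hz, hw⟩ := exists_outerWeight_eq (edgeWeight κ δ γ) (reach b x.1) u L
      (hL.noShortcut.infix (List.suffix_cons x _).isInfix) hlast
    let ω : TreeNode (.node () .nil T) → Vertex d := nodeLabels u isEmptyElim z
    have hω : inorderLabels (.node () .nil T) ω = u :: L := congrArg (u :: ·) hz
    have hlen := (length_inorderLabels _ ω).symm.trans_le (hω ▸ hL.length_le)
    refine ⟨T, mem_treesUpTo.2 (le_trans ?_ hlen), ω, ⟨?_, fun i => ?_⟩, hω, ?_⟩
    · rw [BinaryTree.numNodes]; omega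
    · exact injective_of_nodup_inorderLabels (hω ▸ hL.nodup.of_cons)
    · exact hL.mem_carrier _ (hω ▸ apply_mem_inorderLabels _ ω i)
    · have hreach : ENNReal.ofReal ρ ^ (b * d) ≤ reach b x.1 (L.getLastD u) :=
        (ENNReal.rpow_le_rpow (ENNReal.ofReal_le_ofReal hfar) (by positivity)).trans le_self_add
      calc pathWeight (edgeWeight κ δ γ) x (u :: L) * ENNReal.ofReal ρ ^ (b * d)
          ≤ edgeWeight κ δ γ x u
              * (pathWeight (edgeWeight κ δ γ) u L * reach b x.1 (L.getLastD u)) := by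
            rw [pathWeight_cons, mul_assoc]
            gcongr
        _ = patternWeight κ δ γ b x T ω := by rw [← hw]; rfl

theorem tsum_isFarPath_le (hb : 0 ≤ b) (hρ : 0 < ρ) (η : Configuration d) (x : Vertex d) (N : ℕ) :
    ∑' L : {L // IsFarPath κ δ γ η x N ρ L}, pathWeight (edgeWeight κ δ γ) x L
      ≤ ENNReal.ofReal (ρ ^ (-(b * d))) * ∑ T ∈ treesUpTo N,
        ∑' ω : η.labellings (TreeNode (.node () .nil T)), patternWeight κ δ γ b x T ω := by
  choose T hT ω hω hdec hle using fun L : {L // IsFarPath κ δ γ η x N ρ L} =>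
    L.2.exists_pattern hb hρ
  let J := Σ T : treesUpTo N, η.labellings (TreeNode (.node () .nil T.1))
  let pattern : {L // IsFarPath κ δ γ η x N ρ L} → J := fun L => ⟨⟨T L, hT L⟩, ⟨ω L, hω L⟩⟩
  have hinj : Function.Injective pattern :=
    Function.Injective.of_comp (f := fun j : J => inorderLabels (.node () .nil j.1.1) j.2.1)
      fun L L' h => Subtype.ext ((hdec L).symm.trans (h.trans (hdec L')))
  have hρ' : ENNReal.ofReal ρ ^ (b * d) * ENNReal.ofReal (ρ ^ (-(b * d))) = 1 := by
    rw [ENNReal.ofReal_rpow_of_pos hρ, ← ENNReal.ofReal_mul (by positivity), ← Real.rpow_add hρ,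
      add_neg_cancel, Real.rpow_zero, ENNReal.ofReal_one]
  calc ∑' L : {L // IsFarPath κ δ γ η x N ρ L}, pathWeight (edgeWeight κ δ γ) x L
      = ENNReal.ofReal (ρ ^ (-(b * d))) * ∑' L : {L // IsFarPath κ δ γ η x N ρ L},
          pathWeight (edgeWeight κ δ γ) x L * ENNReal.ofReal ρ ^ (b * d) := by
        rw [ENNReal.tsum_mul_right, mul_comm, mul_assoc, hρ', mul_one]
    _ ≤ ENNReal.ofReal (ρ ^ (-(b * d))) * ∑' L : {L // IsFarPath κ δ γ η x N ρ L},
          patternWeight κ δ γ b x (T L) (ω L) := mul_le_mul' le_rfl (ENNReal.tsum_le_tsum hle)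
    _ ≤ ENNReal.ofReal (ρ ^ (-(b * d))) * ∑' j : J, patternWeight κ δ γ b x j.1.1 j.2.1 :=
        mul_le_mul' le_rfl (ENNReal.tsum_comp_le_tsum_of_injective hinj
          fun j : J => patternWeight κ δ γ b x j.1.1 j.2.1)
    _ = ENNReal.ofReal (ρ ^ (-(b * d))) * ∑ T ∈ treesUpTo N,
          ∑' ω : η.labellings (TreeNode (.node () .nil T)), patternWeight κ δ γ b x T ω := by
        rw [ENNReal.tsum_sigma', tsum_fintype]
        congr 1
        exact Finset.sum_coe_sort (treesUpTo N) fun T =>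
          ∑' ω : η.labellings (TreeNode (.node () .nil T)), patternWeight κ δ γ b x T ω

variable {Λ : Measure (Configuration d)}

theorem IsUnitPoissonLaw.exists_tsum_isFarPath_le_of_lintegral_patternWeight_le
    (hΛ : IsUnitPoissonLaw Λ) (hb : 0 ≤ b) (hρ : 0 < ρ) {x : Vertex d} {C K : ℝ≥0∞}
    (h : ∀ T, ∫⁻ ω, patternWeight κ δ γ b x T ω ∂(Measure.pi fun _ => vertexVolume d)
      ≤ C * K ^ T.numNodes) (N : ℕ) :
    ∃ F : Configuration d → ℝ≥0∞, Measurable F ∧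
      (∀ η, ∑' L : {L // IsFarPath κ δ γ η x N ρ L}, pathWeight (edgeWeight κ δ γ) x L ≤ F η) ∧
      ∫⁻ η, F η ∂Λ ≤ C * (ENNReal.ofReal (ρ ^ (-(b * d))) * (2 * (1 + 4 * K)) ^ N) := by
  choose F hFm hF hFi using fun T : BinaryTree Unit =>
    hΛ.exists_tsum_labellings_le (measurable_patternWeight (κ := κ) (δ := δ) (γ := γ) (b := b) x T)
  have hsum : Measurable fun η => ∑ T ∈ treesUpTo N, F T η :=
    Finset.measurable_fun_sum _ fun T _ => hFm T
  refine ⟨fun η => ENNReal.ofReal (ρ ^ (-(b * d))) * ∑ T ∈ treesUpTo N, F T η,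
    hsum.const_mul _, fun η => (tsum_isFarPath_le hb hρ η x N).trans
      (mul_le_mul' le_rfl (Finset.sum_le_sum fun T _ => hF T η)), ?_⟩
  calc ∫⁻ η, ENNReal.ofReal (ρ ^ (-(b * d))) * ∑ T ∈ treesUpTo N, F T η ∂Λ
      = ENNReal.ofReal (ρ ^ (-(b * d))) * ∑ T ∈ treesUpTo N, ∫⁻ η, F T η ∂Λ := by
        rw [lintegral_const_mul _ hsum, lintegral_finsetSum _ fun T _ => hFm T]
    _ ≤ ENNReal.ofReal (ρ ^ (-(b * d))) * ∑ T ∈ treesUpTo N, C * K ^ T.numNodes :=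
        mul_le_mul' le_rfl (Finset.sum_le_sum fun T _ => (hFi T).trans (h T))
    _ = C * (ENNReal.ofReal (ρ ^ (-(b * d))) * ∑ T ∈ treesUpTo N, K ^ T.numNodes) := by
        rw [← Finset.mul_sum, mul_left_comm]
    _ ≤ C * (ENNReal.ofReal (ρ ^ (-(b * d))) * (2 * (1 + 4 * K)) ^ N) := by
        gcongr
        exact sum_treesUpTo_le K N

theorem IsUnitPoissonLaw.exists_tsum_isFarPath_le (hΛ : IsUnitPoissonLaw Λ) (hd : 1 ≤ d)
    (hκ : 0 < κ) (hδ : 1 < δ) (hγ₀ : 0 ≤ γ) (hγ : γ < δ / (δ + 1)) :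
    ∃ β : ℝ, 0 < β ∧ ∃ B : ℝ, 1 ≤ B ∧ ∀ s, ∃ C : ℝ≥0∞, C ≠ ∞ ∧
      ∀ (x : EuclideanSpace ℝ (Fin d)) (N : ℕ) (ρ : ℝ), 0 < ρ →
        ∃ F : Configuration d → ℝ≥0∞, Measurable F ∧
          (∀ η, ∑' L : {L // IsFarPath κ δ γ η (x, s) N ρ L},
            pathWeight (edgeWeight κ δ γ) (x, s) L ≤ F η) ∧
          ∫⁻ η, F η ∂Λ ≤ C * ENNReal.ofReal (ρ ^ (-β) * B ^ N) := by
  obtain ⟨b, hb, K, hK, hpattern⟩ := exists_lintegral_patternWeight_le hd hκ hδ hγ₀ hγ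
  have hd' : (0 : ℝ) < d := by exact_mod_cast hd
  have hB : 2 * (1 + 4 * K) ≠ ∞ := by finiteness
  have hB1 : 1 ≤ 2 * (1 + 4 * K) := one_le_mul one_le_two le_self_add
  refine ⟨b * d, by positivity, (2 * (1 + 4 * K)).toReal,
    ENNReal.toReal_one ▸ ENNReal.toReal_mono hB hB1, fun s => ?_⟩
  obtain ⟨C, hC, hint⟩ := hpattern s
  refine ⟨C, hC, fun x N ρ hρ => ?_⟩
  rw [ENNReal.ofReal_mul (by positivity), ENNReal.ofReal_pow ENNReal.toReal_nonneg,
    ENNReal.ofReal_toReal hB]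
  exact hΛ.exists_tsum_isFarPath_le_of_lintegral_patternWeight_le hb.le hρ (hint x) N

end FirstMoment

section PalmProbability

variable {d : ℕ} {Λ : Measure (Configuration d)} {𝒢 : GeometricRandomGraph d} {δ γ : ℝ}

theorem palmProb_le_one [IsProbabilityMeasure Λ] (x y : Vertex d)
    (A : Set (SimpleGraph (Vertex d))) : 𝒢.palmProb Λ x y A ≤ 1 := by
  have := 𝒢.isMarkov
  exact (lintegral_mono fun η => prob_le_one).trans_eq (by simp)

theorem palmProb_mono (x y : Vertex d) {A A' : Set (SimpleGraph (Vertex d))} (h : A ⊆ A') :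
    𝒢.palmProb Λ x y A ≤ 𝒢.palmProb Λ x y A' :=
  lintegral_mono fun _ => measure_mono h

theorem one_sub_lintegral_le_palmProb [IsProbabilityMeasure Λ] {x y : Vertex d}
    {A : Set (SimpleGraph (Vertex d))} {F : Configuration d → ℝ≥0∞} (hF : Measurable F)
    (h : ∀ᵐ η ∂Λ, 𝒢.law ((η.addPoint x).addPoint y) Aᶜ ≤ F η) :
    1 - ∫⁻ η, F η ∂Λ ≤ 𝒢.palmProb Λ x y A := by
  have := 𝒢.isMarkov
  calc 1 - ∫⁻ η, F η ∂Λ = ∫⁻ _, 1 ∂Λ - ∫⁻ η, F η ∂Λ := by simp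
    _ ≤ ∫⁻ η, (1 - F η) ∂Λ := lintegral_sub_le' _ _ hF.aemeasurable
    _ ≤ 𝒢.palmProb Λ x y A := by
        refine lintegral_mono_ae (h.mono fun η hη => tsub_le_iff_right.2 ?_)
        calc (1 : ℝ≥0∞) = 𝒢.law ((η.addPoint x).addPoint y) (A ∪ Aᶜ) := by
              rw [Set.union_compl_self, measure_univ]
          _ ≤ 𝒢.law ((η.addPoint x).addPoint y) A + F η :=
              (measure_union_le _ _).trans (add_le_add le_rfl hη)

theorem GeometricRandomGraph.EdgeBound.mono {γ' : ℝ} (h : 𝒢.EdgeBound Λ δ γ) (hδ : 0 ≤ δ)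
    (hγ : γ ≤ γ') : 𝒢.EdgeBound Λ δ γ' := by
  obtain ⟨κ, hκ, hedge⟩ := h
  refine ⟨κ, hκ, fun x y => (hedge x y).mono fun η hη I hmem hswap hcard => ?_⟩
  exact (hη I hmem hswap hcard).trans
    (Finset.prod_le_prod' fun e _ => edgeFactor_mono hκ hδ hγ e.1 e.2)

theorem GeometricRandomGraph.EdgeBound.exists_one_sub_le_palmProb (h : 𝒢.EdgeBound Λ δ γ)
    (hΛ : IsUnitPoissonLaw Λ) (hd : 1 ≤ d) (hδ : 1 < δ) (hγ₀ : 0 ≤ γ) (hγ : γ < δ / (δ + 1)) :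
    ∃ β : ℝ, 0 < β ∧ ∃ B : ℝ, 1 ≤ B ∧ ∀ s t, ∃ (M : ℝ) (C : ℝ≥0∞), C ≠ ∞ ∧
      ∀ x y : EuclideanSpace ℝ (Fin d), x ≠ y → ∀ N : ℕ,
        1 - (ENNReal.ofReal (M * ‖x - y‖ ^ (-(δ * d)))
            + C * ENNReal.ofReal ((‖x - y‖ / 2) ^ (-β) * B ^ N))
          ≤ 𝒢.palmProb Λ (x, s) (y, t) {G | N < G.edist (x, s) (y, t)} := by
  have := hΛ.isProbabilityMeasure
  obtain ⟨κ, hκ, hedge⟩ := h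
  obtain ⟨β, hβ, B, hB, hfar⟩ := hΛ.exists_tsum_isFarPath_le hd hκ hδ hγ₀ hγ
  refine ⟨β, hβ, B, hB, fun s t => ?_⟩
  obtain ⟨Cs, hCs, hs⟩ := hfar s
  obtain ⟨Ct, hCt, ht⟩ := hfar t
  refine ⟨markFactor κ δ γ s t, Cs + Ct, by finiteness, fun x y hxy N => ?_⟩
  have hρ : 0 < ‖x - y‖ / 2 := half_pos (norm_pos_iff.2 (sub_ne_zero.2 hxy))
  obtain ⟨F, hFm, hF, hFi⟩ := hs x N _ hρ
  obtain ⟨F', hFm', hF', hFi'⟩ := ht y N _ hρ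
  have hedist : ∀ᵐ η ∂Λ, 𝒢.law ((η.addPoint (x, s)).addPoint (y, t))
      {G | (N : ℕ∞) < G.edist (x, s) (y, t)}ᶜ
        ≤ edgeFactor κ δ γ (x, s) (y, t) + (F η + F' η) := by
    filter_upwards [hedge (x, s) (y, t)] with η hη
    simp only [Set.compl_ofPred, not_lt]
    exact (hη.law_edist_le (fun h => hxy (congrArg Prod.fst h)) N).trans
      (add_le_add le_rfl (add_le_add (hF η) (hF' η)))
  refine le_trans (tsub_le_tsub_left ?_ 1) (one_sub_lintegral_le_palmProb (by fun_prop) hedist)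
  calc ∫⁻ η, (edgeFactor κ δ γ (x, s) (y, t) + (F η + F' η)) ∂Λ
      = edgeFactor κ δ γ (x, s) (y, t) + (∫⁻ η, F η ∂Λ + ∫⁻ η, F' η ∂Λ) := by
        rw [lintegral_add_left measurable_const, lintegral_add_left hFm, lintegral_const,
          measure_univ, mul_one]
    _ ≤ ENNReal.ofReal (markFactor κ δ γ s t * ‖x - y‖ ^ (-(δ * d)))
        + (Cs + Ct) * ENNReal.ofReal ((‖x - y‖ / 2) ^ (-β) * B ^ N) := by
        rw [edgeFactor_eq_ofReal hκ hxy, add_mul]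
        exact add_le_add le_rfl (add_le_add hFi hFi')

theorem tendsto_palmProb_of_eventually_le [IsProbabilityMeasure Λ] {ℓ ℓ' : ℝ → ℝ}
    (hle : ∀ᶠ r in atTop, ℓ r ≤ ℓ' r) {s t : Set.Ioo (0 : ℝ) 1}
    (h : Tendsto (fun z : EuclideanSpace ℝ (Fin d) × EuclideanSpace ℝ (Fin d) =>
      𝒢.palmProb Λ (z.1, s) (z.2, t)
        {G | ENNReal.ofReal (ℓ' ‖z.1 - z.2‖) ≤ ((G.edist (z.1, s) (z.2, t) : ℕ∞) : ℝ≥0∞)})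
      (comap (fun z => ‖z.1 - z.2‖) atTop) (𝓝 1)) :
    Tendsto (fun z : EuclideanSpace ℝ (Fin d) × EuclideanSpace ℝ (Fin d) =>
      𝒢.palmProb Λ (z.1, s) (z.2, t)
        {G | ENNReal.ofReal (ℓ ‖z.1 - z.2‖) ≤ ((G.edist (z.1, s) (z.2, t) : ℕ∞) : ℝ≥0∞)})
      (comap (fun z => ‖z.1 - z.2‖) atTop) (𝓝 1) := by
  refine tendsto_of_tendsto_of_tendsto_of_le_of_le' h tendsto_const_nhds ?_
    (Eventually.of_forall fun _ => palmProb_le_one _ _ _)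
  filter_upwards [tendsto_comap.eventually hle] with z hz
  exact palmProb_mono _ _ fun G hG => (ENNReal.ofReal_le_ofReal hz).trans hG

end PalmProbability

section Asymptotics

theorem tendsto_rpow_neg_mul_pow_floor {β B c : ℝ} (hB : 1 ≤ B) (hc : 0 ≤ c)
    (hβ : Real.log B * c < β) :
    Tendsto (fun r : ℝ => (r / 2) ^ (-β) * B ^ ⌊c * Real.log r⌋₊) atTop (𝓝 0) := by
  rw [mul_comm] at hβ
  have hlim : Tendsto (fun r : ℝ => 2 ^ β * r ^ (-(β - c * Real.log B))) atTop (𝓝 0) := by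
    simpa using (tendsto_rpow_neg_atTop (sub_pos.2 hβ)).const_mul ((2 : ℝ) ^ β)
  refine squeeze_zero' ?_ ?_ hlim
  · filter_upwards [eventually_gt_atTop 0] with r hr
    positivity
  filter_upwards [eventually_ge_atTop 1] with r hr
  have hr₀ : 0 < r := one_pos.trans_le hr
  have hB₀ : 0 < B := one_pos.trans_le hB
  have hpow : B ^ ⌊c * Real.log r⌋₊ ≤ r ^ (c * Real.log B) :=
    calc B ^ ⌊c * Real.log r⌋₊ = B ^ (⌊c * Real.log r⌋₊ : ℝ) := (Real.rpow_natCast _ _).symm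
      _ ≤ B ^ (c * Real.log r) := Real.rpow_le_rpow_of_exponent_le hB
          (Nat.floor_le (mul_nonneg hc (Real.log_nonneg hr)))
      _ = r ^ (c * Real.log B) := by
          rw [Real.rpow_def_of_pos hB₀, Real.rpow_def_of_pos hr₀]
          ring_nf
  calc (r / 2) ^ (-β) * B ^ ⌊c * Real.log r⌋₊ ≤ (r / 2) ^ (-β) * r ^ (c * Real.log B) := by gcongr
    _ = 2 ^ β * (r ^ (-β) * r ^ (c * Real.log B)) := by
        rw [Real.div_rpow hr₀.le zero_le_two, Real.rpow_neg zero_le_two, div_inv_eq_mul]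
        ring
    _ = 2 ^ β * r ^ (-(β - c * Real.log B)) := by
        rw [← Real.rpow_add hr₀]
        ring_nf

theorem ofReal_le_toENNReal_of_floor_lt {a : ℝ} {e : ℕ∞} (h : (⌊a⌋₊ : ℕ∞) < e) :
    ENNReal.ofReal a ≤ (e : ℝ≥0∞) :=
  calc ENNReal.ofReal a ≤ ((⌊a⌋₊ + 1 : ℕ) : ℝ≥0∞) := by
        rw [← ENNReal.ofReal_natCast]
        exact ENNReal.ofReal_le_ofReal (by exact_mod_cast (Nat.lt_floor_add_one a).le)
    _ = (((⌊a⌋₊ : ℕ∞) + 1 : ℕ∞) : ℝ≥0∞) := by push_cast; rfl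
    _ ≤ e := ENat.toENNReal_mono (Order.add_one_le_of_lt h)

theorem eventually_mul_log_div_le {c p : ℝ} (hc : 0 ≤ c) (hp : 0 ≤ p) :
    ∀ᶠ r in atTop, c * (Real.log r / Real.log (Real.log r) ^ p) ≤ c * Real.log r := by
  filter_upwards [eventually_ge_atTop 1,
    (Real.tendsto_log_atTop.comp Real.tendsto_log_atTop).eventually_ge_atTop 1] with r hr hlog
  exact mul_le_mul_of_nonneg_left
    (div_le_self (Real.log_nonneg hr) (Real.one_le_rpow hlog hp)) hc

end Asymptotics

theorem proposition2p6_general (d : ℕ) (hd : 1 ≤ d) (Λ : Measure (Configuration d))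
    (hΛ : IsUnitPoissonLaw Λ) (𝒢 : GeometricRandomGraph d) (δ γ : ℝ) (hδ : 1 < δ)
    (hγ : γ < δ / (δ + 1)) (h𝒢 : 𝒢.EdgeBound Λ δ γ) :
    ∃ c : ℝ, 0 < c ∧ ∀ s t : Set.Ioo (0 : ℝ) 1,
      Tendsto
        (fun z : EuclideanSpace ℝ (Fin d) × EuclideanSpace ℝ (Fin d) =>
          𝒢.palmProb Λ (z.1, s) (z.2, t)
            {G | ENNReal.ofReal (c * Real.log ‖z.1 - z.2‖)
              ≤ ((G.edist (z.1, s) (z.2, t) : ℕ∞) : ℝ≥0∞)})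
        (comap (fun z => ‖z.1 - z.2‖) atTop) (𝓝 1) := by
  have := hΛ.isProbabilityMeasure
  obtain ⟨β, hβ, B, hB, hbound⟩ :=
    (h𝒢.mono (by linarith) (le_max_left γ 0)).exists_one_sub_le_palmProb hΛ hd hδ
      (le_max_right γ 0) (max_lt hγ (by positivity))
  obtain ⟨c, hc, hcβ⟩ : ∃ c, 0 < c ∧ Real.log B * c < β := exists_pos_mul_lt hβ (Real.log B)
  refine ⟨c, hc, fun s t => ?_⟩
  obtain ⟨M, C, hC, hlow⟩ := hbound s t
  have hdirect : Tendsto (fun r : ℝ => ENNReal.ofReal (M * r ^ (-(δ * d)))) atTop (𝓝 0) := by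
    have hδd : 0 < δ * d := mul_pos (by linarith) (Nat.cast_pos.2 hd)
    simpa using ENNReal.tendsto_ofReal ((tendsto_rpow_neg_atTop hδd).const_mul M)
  have hpaths := ENNReal.Tendsto.const_mul
    (ENNReal.tendsto_ofReal (tendsto_rpow_neg_mul_pow_floor hB hc.le hcβ)) (Or.inr hC)
  have hlim := ENNReal.Tendsto.sub (tendsto_const_nhds (x := (1 : ℝ≥0∞))) (hdirect.add hpaths)
    (Or.inl ENNReal.one_ne_top)
  simp only [ENNReal.ofReal_zero, mul_zero, add_zero, tsub_zero] at hlim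
  refine tendsto_of_tendsto_of_tendsto_of_le_of_le' (hlim.comp tendsto_comap) tendsto_const_nhds ?_
    (Eventually.of_forall fun _ => palmProb_le_one _ _ _)
  filter_upwards [tendsto_comap.eventually (eventually_gt_atTop 0)] with ⟨x, y⟩ hr
  exact (hlow x y (sub_ne_zero.1 (norm_pos_iff.1 hr)) _).trans
    (palmProb_mono _ _ fun G hG => ofReal_le_toENNReal_of_floor_lt hG)

theorem proposition2p6 (d : ℕ) (hd : 1 ≤ d) (Λ : Measure (Configuration d))
    (hΛ : IsUnitPoissonLaw Λ) (𝒢 : GeometricRandomGraph d) (δ γ : ℝ) (hδ : 1 < δ) (hγ₀ : 0 < γ)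
    (hγ : γ < δ / (δ + 1)) (h𝒢 : 𝒢.EdgeBound Λ δ γ) (p : ℝ) (hp : 1 < p) :
    ∃ c : ℝ, 0 < c ∧ ∀ s t : Set.Ioo (0 : ℝ) 1,
      Tendsto
        (fun z : EuclideanSpace ℝ (Fin d) × EuclideanSpace ℝ (Fin d) =>
          𝒢.palmProb Λ (z.1, s) (z.2, t)
            {G | ENNReal.ofReal
                (c * (Real.log ‖z.1 - z.2‖ / Real.log (Real.log ‖z.1 - z.2‖) ^ p))
              ≤ ((G.edist (z.1, s) (z.2, t) : ℕ∞) : ℝ≥0∞)})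
        (comap (fun z : EuclideanSpace ℝ (Fin d) × EuclideanSpace ℝ (Fin d) => ‖z.1 - z.2‖) atTop)
        (𝓝 1) := by
  have := hΛ.isProbabilityMeasure
  obtain ⟨c, hc, h⟩ := proposition2p6_general d hd Λ hΛ 𝒢 δ γ hδ hγ h𝒢
  exact ⟨c, hc, fun s t => tendsto_palmProb_of_eventually_le
    (eventually_mul_log_div_le hc.le (by linarith)) (h s t)⟩
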